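/- Let $H_1,H_2$ be real separable Hilbert spaces with $\dim H_1=\infty$, and let all random variables be defined on one probability space $(\Omega,\mathcal A,P)$. For $x\in H_i$, $y\in H_j$ write $x\otimes y$ for the operator $v\mapsto\langle x,v\rangle y$, and $\|\cdot\|_{\mathcal L}$ for the operator norm. Consider the model $$Y_k=\Psi(X_k)+\varepsilon_k,\qquad k\ge 1,$$ with a bounded linear operator $\Psi:H_1\to H_2$, where: (A) $(X_k)_{k\ge1}$ in $H_1$ and $(\varepsilon_k)_{k\ge1}$ in $H_2$ have mean zero and are $L^4$–$m$–approximable with respect to a common innovation sequence. That is, there are i.i.d. random elements $(\delta_i)_{i\in\mathbb Z}$ of a measurable space $S$, an independent copy $(\delta_i')_{i\in\mathbb Z}$ of this sequence, and measurable maps $f:S^{\mathbb N}\to H_1$, $g:S^{\mathbb N}\to H_2$ such that $X_n=f(\delta_n,\delta_{n-1},\dots)$ and $\varepsilon_n=g(\delta_n,\delta_{n-1},\dots)$ almost surely, $E\|X_n\|^4<\infty$ and $E\|\varepsilon_n\|^4<\infty$ for $n\ge 1$, and $$\sum_{m\ge1}\big(E\|X_m-X_m^{(m)}\|^4\big)^{1/4}<\infty,\qquad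 \sum_{m\ge1}\big(E\|\varepsilon_m-\varepsilon_m^{(m)}\|^4\big)^{1/4}<\infty,$$ where $X_m^{(m)}=f(\delta_m,\dots,\delta_1,\delta_0',\delta_{-1}',\dots)$ and $\varepsilon_m^{(m)}=g(\delta_m,\dots,\delta_1,\delta_0',\delta_{-1}',\dots)$. Moreover $(\varepsilon_k)$ is $H_2$–white noise (that is, $E[\varepsilon_j\otimes\varepsilon_k]=0$ for $j\ne k$, with mean and covariance operator not depending on $k$), and $X_k\perp\varepsilon_k$, i.e. $E[X_k\otimes\varepsilon_k]=0$, for every $k\ge1$. Suppose that the covariance operator $C=E[X_1\otimes X_1]$ has dense range in $H_1$, that its eigenvalues $\lambda_1\ge\lambda_2\ge\cdots$, listed with multiplicity, are mutually distinct, and that $\Psi$ is a Hilbert–Schmidt operator. Let $\hat C_n=\frac1n\sum_{k=1}^nX_k\otimes X_k$ and $\hat\Delta_n=\frac1n\sum_{k=1}^nX_k\otimes Y_k$. Let $\hat\lambda_1\ge\hat\lambda_2\ge\cdots\ge 0$ be the eigenvalues of $\hat C_n$, listed with multiplicity, with any choice of corresponding orthonormal eigenvectors $\hat v_1,\hat v_2,\dots$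 (all depending on $n$). Put $\hat\alpha_1=\hat\lambda_1-\hat\lambda_2$ and $\hat\alpha_j=\min\{\hat\lambda_{j-1}-\hat\lambda_j,\ \hat\lambda_j-\hat\lambda_{j+1}\}$ for $j>1$, and $$\hat\Psi_K(x)=\sum_{j=1}^K\frac{\hat\Delta_n(\hat v_j)}{\hat\lambda_j}\langle\hat v_j,x\rangle .$$ (K) Let $m_n$ be real numbers with $m_n\to\infty$ and $m_n^6=o(n)$, and let $K_n=\min(B_n,E_n,\lfloor m_n\rfloor)$, where $$B_n=\max\{j\ge1:\hat\lambda_j^{-1}\le m_n\},\qquad E_n=\max\Big\{k\ge1:\max_{1\le j\le k}\hat\alpha_j^{-1}\le m_n\Big\},$$ with $0^{-1}=\infty$ and $\max\emptyset=0$. Then $\|\hat\Psi_{K_n}-\Psi\|_{\mathcal L}\to0$ in probability as $n\to\infty$. -/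

import Mathlib

open MeasureTheory ProbabilityTheory Filter Topology Asymptotics
open scoped ENNReal

noncomputable section

namespace HilbertLM

section Operators

variable {H H₁ H₂ : Type*}
  [NormedAddCommGroup H] [InnerProductSpace ℝ H]
  [NormedAddCommGroup H₁] [InnerProductSpace ℝ H₁]
  [NormedAddCommGroup H₂] [InnerProductSpace ℝ H₂]

/-- `x ⊗ y`, the operator `v ↦ ⟪x, v⟫ y`. -/
def tensor (x : H₁) (y : H₂) : H₁ →L[ℝ] H₂ := InnerProductSpace.rankOne ℝ y x

/-- `Φ` is Hilbert–Schmidt: `∑ ‖Φ e‖² < ∞` along orthonormal bases `(e)` of the domain. -/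
def IsHilbertSchmidt (Φ : H₁ →L[ℝ] H₂) : Prop :=
  ∀ (s : Set H₁) (e : HilbertBasis s ℝ H₁), Summable fun i => ‖Φ (e i)‖ ^ 2

/-- `(lam j, v j)`, `j = 0, 1, 2, …`, lists the eigenvalues of `T` in decreasing order together
with corresponding orthonormal eigenvectors, every nonzero eigenvalue being repeated according to
its multiplicity. If `T` is positive of finite rank `r` on an infinite dimensional space, then
`lam j = 0` for all `j ≥ r`. Indices start at `0`: the `j`-th largest
eigenvalue, `j ≥ 1`, is `lam (j - 1)`. -/
structure IsEigenSystem (T : H →L[ℝ] H) (lam : ℕ → ℝ) (v : ℕ → H) : Prop where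
  orthonormal : Orthonormal ℝ v
  eigen : ∀ j, T (v j) = lam j • v j
  antitone : Antitone lam
  complete : ∀ μ : ℝ, μ ≠ 0 → ∀ x, T x = μ • x → x ∈ Submodule.span ℝ (v '' {j | lam j = μ})

/-- The spectral gaps: `α_1 = λ_1 - λ_2` and `α_j = min (λ_{j-1} - λ_j) (λ_j - λ_{j+1})` for
`j > 1` (the code is indexed from `0`). -/
def gap (lam : ℕ → ℝ) : ℕ → ℝ
  | 0 => lam 0 - lam 1
  | j + 1 => min (lam j - lam (j + 1)) (lam (j + 1) - lam (j + 2))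

/-- `B = max {j ≥ 1 | λ_j⁻¹ ≤ m}` where `0⁻¹ = ∞`; it is `0` if there is no such `j`. -/
def truncB (lam : ℕ → ℝ) (m : ℝ) : ℕ :=
  sSup {j : ℕ | 1 ≤ j ∧ 0 < lam (j - 1) ∧ (lam (j - 1))⁻¹ ≤ m}

/-- `E = max {k ≥ 1 | max_{1 ≤ j ≤ k} α_j⁻¹ ≤ m}` where `0⁻¹ = ∞`; it is `0` if there is no
such `k`. -/
def truncE (lam : ℕ → ℝ) (m : ℝ) : ℕ :=
  sSup {k : ℕ | 1 ≤ k ∧ ∀ j < k, 0 < gap lam j ∧ (gap lam j)⁻¹ ≤ m}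

/-- `K = min (B, E, m)`, with `m` rounded down to an integer. -/
def truncK (lam : ℕ → ℝ) (m : ℝ) : ℕ :=
  min (min (truncB lam m) (truncE lam m)) ⌊m⌋₊

/-- `∑_{j=1}^K v_j ⊗ (λ_j⁻¹ D(v_j))`, i.e. the operator `x ↦ ∑_{j=1}^K (D(v_j) / λ_j) ⟪v_j, x⟫`. -/
def pcaOperator (D : H₁ →L[ℝ] H₂) (lam : ℕ → ℝ) (v : ℕ → H₁) (K : ℕ) : H₁ →L[ℝ] H₂ :=
  ∑ j ∈ Finset.range K, tensor (v j) ((lam j)⁻¹ • D (v j))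

end Operators

section Probability

variable {Ω H H₁ H₂ S : Type*} [MeasurableSpace Ω] [MeasurableSpace S]
  [NormedAddCommGroup H] [InnerProductSpace ℝ H]
  [NormedAddCommGroup H₁] [InnerProductSpace ℝ H₁]
  [NormedAddCommGroup H₂] [InnerProductSpace ℝ H₂]

/-- `E[X ⊗ Y]` (a Bochner integral in the operator norm). -/
def crossMoment (P : Measure Ω) (X : Ω → H₁) (Y : Ω → H₂) : H₁ →L[ℝ] H₂ :=
  ∫ ω, tensor (X ω) (Y ω) ∂P

/-- The covariance operator `E[(X - EX) ⊗ (X - EX)]`. -/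
def covOp (P : Measure Ω) (X : Ω → H) : H →L[ℝ] H :=
  crossMoment P (fun ω => X ω - ∫ ω', X ω' ∂P) (fun ω => X ω - ∫ ω', X ω' ∂P)

/-- `X ⊥ Y`: both have two moments and `E[X ⊗ Y] = 0`. -/
def Orthogonal (P : Measure Ω) (X : Ω → H₁) (Y : Ω → H₂) : Prop :=
  MemLp X 2 P ∧ MemLp Y 2 P ∧ crossMoment P X Y = 0

/-- `(ε_k)_{k ≥ 1}` is `H`-white noise: pairwise orthogonal, with constant mean and constant
covariance operator. -/
structure IsWhiteNoise (P : Measure Ω) (ε : ℕ → Ω → H) : Prop where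
  memLp : ∀ k, 1 ≤ k → MemLp (ε k) 2 P
  orthogonal : ∀ j k, 1 ≤ j → 1 ≤ k → j ≠ k → Orthogonal P (ε j) (ε k)
  mean_const : ∀ k, 1 ≤ k → ∫ ω, ε k ω ∂P = ∫ ω, ε 1 ω ∂P
  cov_const : ∀ k, 1 ≤ k → covOp P (ε k) = covOp P (ε 1)

/-- `(δ_i)_{i ∈ ℤ}` is i.i.d. and `(δ'_i)_{i ∈ ℤ}` is an independent copy of it. -/
structure IsIIDWithCopy (P : Measure Ω) (δ δ' : ℤ → Ω → S) : Prop where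
  measurable : ∀ i, Measurable (δ i)
  measurable_copy : ∀ i, Measurable (δ' i)
  indep : iIndepFun (Sum.elim δ δ') P
  identDistrib : ∀ i, IdentDistrib (δ i) (δ 0) P P
  identDistrib_copy : ∀ i, IdentDistrib (δ' i) (δ 0) P P

/-- The sequence `(δ_n, δ_{n-1}, δ_{n-2}, …)`. -/
def past (δ : ℤ → Ω → S) (n : ℤ) (ω : Ω) : ℕ → S := fun i => δ (n - i) ω

/-- The sequence `(δ_n, …, δ_{n-m+1}, δ'_{n-m}, δ'_{n-m-1}, …)`. -/
def coupledPast (δ δ' : ℤ → Ω → S) (n : ℤ) (m : ℕ) (ω : Ω) : ℕ → S :=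
  fun i => if i < m then δ (n - i) ω else δ' (n - i) ω

/-- `(X_n)_{n ≥ 1}` is `L^p`-`m`-approximable with the representation `X_n = f(δ_n, δ_{n-1}, …)`,
where `δ'` is the copy of `δ`: the `X_n` have `p` moments, and
`∑_{m ≥ 1} ν_p(X_m - X_m^{(m)}) < ∞` for
`X_m^{(m)} = f(δ_m, …, δ_1, δ'_0, δ'_{-1}, …)`. -/
structure IsLpmApproximable [MeasurableSpace H] (P : Measure Ω) (p : ℝ≥0∞)
    (δ δ' : ℤ → Ω → S) (f : (ℕ → S) → H) (X : ℕ → Ω → H) : Prop where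
  measurable : Measurable f
  memLp : ∀ n, 1 ≤ n → MemLp (X n) p P
  repr : ∀ n : ℕ, 1 ≤ n → ∀ᵐ ω ∂P, X n ω = f (past δ n ω)
  summable : ∑' i : ℕ,
    eLpNorm (fun ω => X (i + 1) ω - f (coupledPast δ δ' ((i + 1 : ℕ) : ℤ) (i + 1) ω)) p P < ∞

/-- `n⁻¹ ∑_{k=1}^n X_k ⊗ Y_k`. -/
def empCrossMoment (X : ℕ → Ω → H₁) (Y : ℕ → Ω → H₂) (n : ℕ) (ω : Ω) : H₁ →L[ℝ] H₂ :=
  (n : ℝ)⁻¹ • ∑ k ∈ Finset.Icc 1 n, tensor (X k ω) (Y k ω)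

end Probability

end HilbertLM

end

/-! Write `Ĉ` for the empirical covariance, `L` for the empirical cross moment of `X` and `ε`, and
`R` for the projection off the first `K` empirical eigenvectors. The model gives `Δ̂ = Ψ Ĉ + L`.
Since `Ĉ v̂_j = λ̂_j v̂_j`, the division by `λ̂_j` cancels exactly on the main term, so the error of
the estimator is `-Ψ R` plus a noise term of norm at most `m² ‖L‖` (`norm_pcaOperator_sub_le`).

Consistency of the eigenvectors is never needed. As `Ψ` is nearly of finite rank, `‖Ψ R‖` is small
once `R e` is small for finitely many `e`. Density of the range gives `e ≈ C z ≈ Ĉ z`, and `‖R Ĉ z‖`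
is at most the first discarded empirical eigenvalue times `‖z‖`
(`IsHilbertSchmidt.exists_norm_comp_le`). That eigenvalue is small because, by Weyl's inequality,
the positive gaps of `C` force `K` past any fixed index (`IsEigenSystem.exists_lam_truncK_le`).

Both `Ĉ - C` and `L` are `O_P(n^{-1/2})` (`tendsto_measure_empCrossMoment_sub`). The variance
computation takes place in the Hilbert tensor product, whose norm comes from an inner product and
dominates the operator norm. Coupling makes the autocovariances summable there. -/

open scoped InnerProductSpace TensorProduct

namespace HilbertLM

/-! ### Eigenvalues of compact positive operators -/

section Spectral

variable {H : Type*} [NormedAddCommGroup H] [InnerProductSpace ℝ H]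
  {T T' : H →L[ℝ] H} {lam lam' : ℕ → ℝ} {v v' : ℕ → H}

theorem IsEigenSystem.eq_inner (h : IsEigenSystem T lam v) (j : ℕ) :
    lam j = ⟪T (v j), v j⟫_ℝ := by
  rw [h.eigen, real_inner_smul_left, real_inner_self_eq_norm_sq, h.orthonormal.1 j]
  simp

theorem IsEigenSystem.nonneg (h : IsEigenSystem T lam v) (hT : T.IsPositive) (j : ℕ) :
    0 ≤ lam j := by
  rw [h.eq_inner j]
  exact hT.inner_nonneg_left (v j)

/-- A compact positive operator is bounded by its `k`-th eigenvalue on the orthogonal complement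
of the first `k` eigenvectors. -/
theorem IsEigenSystem.norm_apply_le_of_orthogonal [CompleteSpace H] (h : IsEigenSystem T lam v)
    (hT : T.IsPositive) (hc : IsCompactOperator T) {k : ℕ} {x : H}
    (hx : ∀ i < k, ⟪v i, x⟫_ℝ = 0) : ‖T x‖ ≤ lam k * ‖x‖ := by
  set V : Submodule ℝ H := (Submodule.span ℝ (v '' Set.Iio k))ᗮ with hV
  have memV (y : H) : y ∈ V ↔ ∀ i < k, ⟪v i, y⟫_ℝ = 0 := by
    rw [hV, Submodule.mem_orthogonal]
    refine ⟨fun H i hi => H _ (Submodule.subset_span ⟨i, hi, rfl⟩), fun H u hu => ?_⟩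
    induction hu using Submodule.span_induction with
    | mem u hu => obtain ⟨i, hi, rfl⟩ := hu; exact H i hi
    | zero => simp
    | add a b _ _ ha hb => rw [inner_add_left, ha, hb, add_zero]
    | smul c a _ ha => rw [real_inner_smul_left, ha, mul_zero]
  have hinv : ∀ y ∈ V, T y ∈ V := by
    intro y hy
    rw [memV] at hy ⊢
    intro i hi
    have := hT.isSymmetric (v i) y
    simp only [ContinuousLinearMap.coe_coe] at this
    rw [← this, h.eigen, real_inner_smul_left, hy i hi, mul_zero]
  let S : V →L[ℝ] V := T.restrict hinv
  have hSc : IsCompactOperator S := hc.restrict' hinv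
  have hSs : S.IsSymmetric := hT.isSymmetric.restrict_invariant hinv
  -- For the self-adjoint `S` the norm is the spectral radius. If it exceeded `lam k`, compactness
  -- would give an eigenvalue above `lam k`, whose eigenvector lies in the span of the first `k` by
  -- `complete` and is also orthogonal to it.
  have key : ‖S‖ ≤ lam k := by
    by_contra! hlt
    have hr := S.spectralRadius_eq_nnnorm hSs.isSelfAdjoint
    have h0 : (ENNReal.ofReal (lam k)) < spectralRadius ℝ S := by
      rw [hr, ← enorm_eq_nnnorm, ← ofReal_norm]
      exact (ENNReal.ofReal_lt_ofReal_iff ((h.nonneg hT k).trans_lt hlt)).2 hlt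
    rw [spectralRadius] at h0
    obtain ⟨μ, h0⟩ := lt_iSup_iff.1 h0
    obtain ⟨hμ, h0⟩ := lt_iSup_iff.1 h0
    rw [← enorm_eq_nnnorm, ← ofReal_norm] at h0
    have h1 : lam k < |μ| := (ENNReal.ofReal_lt_ofReal_iff_of_nonneg (h.nonneg hT k)).1 h0
    have hμ0 : μ ≠ 0 := abs_pos.1 ((h.nonneg hT k).trans_lt h1)
    obtain ⟨y, hy⟩ := ((hSc.hasEigenvalue_iff_mem_spectrum hμ0).2 hμ).exists_hasEigenvector
    have hy1 : T (y : H) = μ • (y : H) := by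
      have := congrArg (Subtype.val) hy.apply_eq_smul
      simpa [S] using this
    have hy0 : (y : H) ≠ 0 := fun h' => hy.2 (Subtype.ext h')
    have hμn : 0 ≤ μ := by
      have := hT.inner_nonneg_left (y : H)
      rw [hy1, real_inner_smul_left, real_inner_self_eq_norm_sq] at this
      have hp : 0 < ‖(y : H)‖ ^ 2 := by positivity
      exact nonneg_of_mul_nonneg_left this hp
    rw [abs_of_nonneg hμn] at h1
    have hspan := h.complete μ hμ0 y hy1
    have hle : Submodule.span ℝ (v '' {j | lam j = μ}) ≤ Submodule.span ℝ (v '' Set.Iio k) := by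
      apply Submodule.span_mono
      apply Set.image_mono
      intro j hj
      by_contra hjk
      have := h.antitone (not_lt.1 hjk)
      simp only [Set.mem_ofPred_eq] at hj
      linarith
    have := y.2 y (hle hspan)
    exact hy0 (inner_self_eq_zero.1 this)
  have hxV : x ∈ V := (memV x).2 hx
  calc ‖T x‖ = ‖S ⟨x, hxV⟩‖ := rfl
    _ ≤ ‖S‖ * ‖(⟨x, hxV⟩ : V)‖ := S.le_opNorm _
    _ ≤ lam k * ‖x‖ := mul_le_mul_of_nonneg_right key (norm_nonneg x)

/-- Weyl's inequality. -/
theorem IsEigenSystem.le_add_norm_sub [CompleteSpace H] (h : IsEigenSystem T lam v)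
    (h' : IsEigenSystem T' lam' v') (hT' : T'.IsPositive) (hc' : IsCompactOperator T') (k : ℕ) :
    lam k ≤ lam' k + ‖T - T'‖ := by
  let e : (Fin (k + 1) → ℝ) →ₗ[ℝ] H := Fintype.linearCombination ℝ (fun i : Fin (k + 1) => v i)
  -- A dimension count, `k + 1 > k`, yields a nonzero `x` in the span of `v 0, …, v k` orthogonal to
  -- `v' 0, …, v' (k - 1)`; the two bounds on `⟪T x, x⟫` are then compared.
  let A : (Fin (k + 1) → ℝ) →ₗ[ℝ] (Fin k → ℝ) :=
    LinearMap.pi fun i : Fin k => (innerSL ℝ (v' i)).toLinearMap ∘ₗ e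
  obtain ⟨a, haA, ha0⟩ := Submodule.exists_mem_ne_zero_of_ne_bot
    (LinearMap.ker_ne_bot_of_finrank_lt (f := A) (by simp))
  set x := e a with hx
  have hex : x = ∑ i : Fin (k + 1), a i • v i := by simp [hx, e, Fintype.linearCombination_apply]
  have hon : Orthonormal ℝ (fun i : Fin (k + 1) => v i) :=
    h.orthonormal.comp _ Fin.val_injective
  have hxn : ‖x‖ ^ 2 = ∑ i, a i ^ 2 := by
    rw [← real_inner_self_eq_norm_sq, hex, hon.inner_sum]
    simp [sq]
  have hx0 : 0 < ‖x‖ ^ 2 := by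
    rw [hxn]
    obtain ⟨i, hi⟩ := Function.ne_iff.1 ha0
    exact Finset.sum_pos' (fun i _ => sq_nonneg _) ⟨i, Finset.mem_univ _, by
      have : a i ≠ 0 := hi
      positivity⟩
  have horth : ∀ i < k, ⟪v' i, x⟫_ℝ = 0 := by
    intro i hi
    exact congrFun (LinearMap.mem_ker.1 haA) ⟨i, hi⟩
  have hTx : ⟪T x, x⟫_ℝ = ∑ i : Fin (k + 1), lam i * a i ^ 2 := by
    have : T x = ∑ i : Fin (k + 1), (lam i * a i) • v i := by
      rw [hex, map_sum]
      refine Finset.sum_congr rfl fun i _ => ?_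
      rw [map_smul, h.eigen, smul_smul, mul_comm]
    rw [this, hex, hon.inner_sum]
    refine Finset.sum_congr rfl fun i _ => ?_
    simp; ring
  have h1 : lam k * ‖x‖ ^ 2 ≤ ⟪T x, x⟫_ℝ := by
    rw [hTx, hxn, Finset.mul_sum]
    gcongr with i
    exact h.antitone (Nat.lt_succ_iff.1 i.2)
  have h2 : ⟪T x, x⟫_ℝ ≤ (lam' k + ‖T - T'‖) * ‖x‖ ^ 2 := by
    have e1 : ⟪T x, x⟫_ℝ = ⟪T' x, x⟫_ℝ + ⟪(T - T') x, x⟫_ℝ := by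
      rw [← inner_add_left]; simp
    have e2 := real_inner_le_norm (T' x) x
    have e3 := real_inner_le_norm ((T - T') x) x
    have e4 := h'.norm_apply_le_of_orthogonal hT' hc' horth
    have e5 := (T - T').le_opNorm x
    have e6 := mul_le_mul_of_nonneg_right e4 (norm_nonneg x)
    have e7 := mul_le_mul_of_nonneg_right e5 (norm_nonneg x)
    nlinarith
  exact le_of_mul_le_mul_right (h1.trans h2) hx0

/-- If the eigenvalues stayed above `c > 0`, the orthogonal vectors `T (v n)` would be at mutual
distance at least `c`, leaving no Cauchy subsequence. -/
theorem IsEigenSystem.tendsto_zero (h : IsEigenSystem T lam v) (hT : T.IsPositive)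
    (hc : IsCompactOperator T) : Tendsto lam atTop (𝓝 0) := by
  rw [Metric.tendsto_atTop]
  intro c hc0
  suffices ∃ N, lam N < c by
    obtain ⟨N, hN⟩ := this
    refine ⟨N, fun n hn => ?_⟩
    rw [Real.dist_eq, sub_zero, abs_of_nonneg (h.nonneg hT n)]
    exact (h.antitone hn).trans_lt hN
  by_contra! hge
  obtain ⟨K, hK, hK'⟩ := hc.image_closedBall_subset_compact 1
  obtain ⟨y, -, ψ, hψ, hψy⟩ := hK.tendsto_subseq (x := fun n => T (v n))
    (fun n => hK' ⟨v n, by simp [h.orthonormal.1 n], rfl⟩)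
  obtain ⟨N, hN⟩ := Metric.cauchySeq_iff'.1 hψy.cauchySeq c hc0
  have h1 := hN (N + 1) (Nat.le_succ N)
  have hne : ψ (N + 1) ≠ ψ N := fun h' => by simpa using hψ.injective h'
  simp only [Function.comp_apply, dist_eq_norm, h.eigen] at h1
  have h2 : ‖lam (ψ (N + 1)) • v (ψ (N + 1)) - lam (ψ N) • v (ψ N)‖ ^ 2
      = lam (ψ (N + 1)) ^ 2 + lam (ψ N) ^ 2 := by
    rw [norm_sub_sq_real, real_inner_smul_left, real_inner_smul_right, h.orthonormal.2 hne,
      norm_smul, norm_smul, h.orthonormal.1, h.orthonormal.1]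
    simp
  have h3 : c ^ 2 ≤ lam (ψ (N + 1)) ^ 2 := by
    have := hge (ψ (N + 1))
    gcongr
  have h4 := sq_nonneg (lam (ψ N))
  nlinarith [norm_nonneg (lam (ψ (N + 1)) • v (ψ (N + 1)) - lam (ψ N) • v (ψ N))]

end Spectral

/-! ### The truncation index -/

section Truncation

variable {lam : ℕ → ℝ} {m : ℝ}

/-- Needed because `sSup` of an unbounded set of naturals is `0`: only with this bound is `truncB` a
genuine maximum. -/
theorem bddAbove_truncB (hl : Tendsto lam atTop (𝓝 0)) (hm : 0 < m) :
    BddAbove {j : ℕ | 1 ≤ j ∧ 0 < lam (j - 1) ∧ (lam (j - 1))⁻¹ ≤ m} := by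
  obtain ⟨N, hN⟩ := (hl.eventually (gt_mem_nhds (inv_pos.2 hm))).exists_forall_of_atTop
  refine ⟨N, fun j ⟨_, h2, h3⟩ => ?_⟩
  by_contra hj
  have h4 := hN (j - 1) (by omega)
  exact absurd (inv_le_of_inv_le₀ h2 h3) (not_le.2 h4)

theorem gap_le (h0 : ∀ j, 0 ≤ lam j) (j : ℕ) : gap lam j ≤ lam j := by
  cases j with
  | zero => simpa [gap] using h0 1
  | succ j => exact (min_le_right _ _).trans (by simpa using h0 (j + 2))

theorem bddAbove_truncE (h0 : ∀ j, 0 ≤ lam j) (hl : Tendsto lam atTop (𝓝 0)) (hm : 0 < m) :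
    BddAbove {k : ℕ | 1 ≤ k ∧ ∀ j < k, 0 < gap lam j ∧ (gap lam j)⁻¹ ≤ m} := by
  refine (bddAbove_truncB hl hm).mono fun k ⟨h1, h2⟩ => ?_
  obtain ⟨h3, h4⟩ := h2 (k - 1) (by omega)
  have h5 := gap_le h0 (k - 1)
  exact ⟨h1, h3.trans_le h5, (inv_anti₀ h3 h5).trans h4⟩

theorem inv_le_of_lt_truncK (ha : Antitone lam) (hl : Tendsto lam atTop (𝓝 0)) (hm : 0 < m)
    {j : ℕ} (hj : j < truncK lam m) : 0 < lam j ∧ (lam j)⁻¹ ≤ m := by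
  have hB : j < truncB lam m := hj.trans_le ((min_le_left _ _).trans (min_le_left _ _))
  have hne : {j : ℕ | 1 ≤ j ∧ 0 < lam (j - 1) ∧ (lam (j - 1))⁻¹ ≤ m}.Nonempty := by
    by_contra hne
    rw [truncB, Set.not_nonempty_iff_eq_empty.1 hne] at hB
    simp at hB
  obtain ⟨-, h2, h3⟩ := Nat.sSup_mem hne (bddAbove_truncB hl hm)
  have h4 : lam (truncB lam m - 1) ≤ lam j := ha (by omega)
  exact ⟨h2.trans_le h4, (inv_anti₀ h2 h4).trans h3⟩

/-- A lower bound on the gaps is enough for both maxima, since each eigenvalue dominates its gap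
(`gap_le`). -/
theorem le_truncK (h0 : ∀ j, 0 ≤ lam j) (hl : Tendsto lam atTop (𝓝 0)) (hm : 0 < m)
    {k : ℕ} (hk : 1 ≤ k) (hkm : (k : ℝ) ≤ m) (hgap : ∀ j < k, m⁻¹ ≤ gap lam j) :
    k ≤ truncK lam m := by
  have hm' : 0 < m⁻¹ := inv_pos.2 hm
  have hlam : m⁻¹ ≤ lam (k - 1) := (hgap (k - 1) (by omega)).trans (gap_le h0 _)
  refine le_min (le_min ?_ ?_) (Nat.le_floor hkm)
  · exact le_csSup (bddAbove_truncB hl hm)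
      ⟨hk, hm'.trans_le hlam, inv_le_of_inv_le₀ hm hlam⟩
  · exact le_csSup (bddAbove_truncE h0 hl hm)
      ⟨hk, fun j hj => ⟨hm'.trans_le (hgap j hj), inv_le_of_inv_le₀ hm (hgap j hj)⟩⟩

theorem gap_pos (ha : StrictAnti lam) (j : ℕ) : 0 < gap lam j := by
  cases j with
  | zero => exact sub_pos.2 (ha one_pos)
  | succ j => exact lt_min (sub_pos.2 (ha (Nat.lt_succ_self _))) (sub_pos.2 (ha (Nat.lt_succ_self _)))

theorem gap_sub_le {lam' : ℕ → ℝ} {d : ℝ} (h : ∀ j, |lam j - lam' j| ≤ d) (j : ℕ) :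
    gap lam j - 2 * d ≤ gap lam' j := by
  have hd (i : ℕ) : lam i - lam (i + 1) - 2 * d ≤ lam' i - lam' (i + 1) := by
    have h1 := abs_le.1 (h i)
    have h2 := abs_le.1 (h (i + 1))
    linarith
  cases j with
  | zero => exact hd 0
  | succ j =>
    exact le_min ((sub_le_sub_right (min_le_left _ _) _).trans (hd j))
      ((sub_le_sub_right (min_le_right _ _) _).trans (hd (j + 1)))

end Truncation

/-! ### Stability of eigenvalues and of the truncation index -/

section Consistency

variable {H : Type*} [NormedAddCommGroup H] [InnerProductSpace ℝ H] [CompleteSpace H]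
  {T T' : H →L[ℝ] H} {lam lam' : ℕ → ℝ} {v v' : ℕ → H}

theorem IsEigenSystem.abs_sub_le (h : IsEigenSystem T lam v) (h' : IsEigenSystem T' lam' v')
    (hT : T.IsPositive) (hc : IsCompactOperator T) (hT' : T'.IsPositive)
    (hc' : IsCompactOperator T') (k : ℕ) : |lam k - lam' k| ≤ ‖T - T'‖ := by
  rw [abs_le]
  have h1 := h.le_add_norm_sub h' hT' hc' k
  have h2 := h'.le_add_norm_sub h hT hc k
  rw [norm_sub_rev] at h2
  constructor <;> linarith

/-- If `T` has distinct eigenvalues and `T'` is close to `T`, then the eigenvalue of `T'` at the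
truncation index is small as soon as the tuning parameter is large. -/
theorem IsEigenSystem.exists_lam_truncK_le (h : IsEigenSystem T lam v) (hT : T.IsPositive)
    (hc : IsCompactOperator T) (hinj : Function.Injective lam) {η : ℝ} (hη : 0 < η) :
    ∃ κ > 0, ∃ M > 0, ∀ (T' : H →L[ℝ] H) (lam' : ℕ → ℝ) (v' : ℕ → H) (m : ℝ),
      IsEigenSystem T' lam' v' → T'.IsPositive → IsCompactOperator T' →
      ‖T - T'‖ ≤ κ → M ≤ m → lam' (truncK lam' m) ≤ η := by
  have hanti : StrictAnti lam := h.antitone.strictAnti_of_injective hinj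
  obtain ⟨k, hk1, hk⟩ : ∃ k, 1 ≤ k ∧ lam k < η / 2 :=
    ((eventually_ge_atTop 1).and
      ((h.tendsto_zero hT hc).eventually (gt_mem_nhds (half_pos hη)))).exists
  obtain ⟨c, hc0, hcgap⟩ : ∃ c > 0, ∀ j < k, c ≤ gap lam j := by
    obtain ⟨i, -, hi⟩ := Finset.exists_min_image (Finset.range k) (gap lam)
      ⟨0, Finset.mem_range.2 hk1⟩
    exact ⟨gap lam i, gap_pos hanti i, fun j hj => hi j (Finset.mem_range.2 hj)⟩
  -- A perturbation of size `c / 4` costs each gap at most `c / 2`, so gaps of at least `c / 2 ≥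
  -- m⁻¹` remain. The bound `η / 2` pays for the shift of `lam k`, and `k ≤ m` for the rounded-down
  -- `m` in `truncK`.
  refine ⟨min (η / 2) (c / 4), by positivity, max (k : ℝ) (2 / c), by positivity, ?_⟩
  intro T' lam' v' m h' hT' hc' hTT' hm
  have hd := h.abs_sub_le h' hT hc hT' hc'
  have hm1 : (k : ℝ) ≤ m := (le_max_left _ _).trans hm
  have hm2 : 2 / c ≤ m := (le_max_right _ _).trans hm
  have hm0 : 0 < m := (by positivity : 0 < 2 / c).trans_le hm2
  have hmi : m⁻¹ ≤ c / 2 := by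
    rw [← inv_div]; exact inv_anti₀ (by positivity) hm2
  have hκ1 := hTT'.trans (min_le_left _ _)
  have hκ2 := hTT'.trans (min_le_right _ _)
  have hK : k ≤ truncK lam' m := by
    refine le_truncK (h'.nonneg hT') (h'.tendsto_zero hT' hc') hm0 hk1 hm1 fun j hj => ?_
    have h1 := gap_sub_le hd j
    have h2 := hcgap j hj
    linarith
  have h1 := h'.antitone hK
  have h2 := (abs_le.1 (hd k)).1
  linarith

end Consistency

/-! ### The residual projection and the error decomposition -/

section Projection

variable {H H₂ : Type*} [NormedAddCommGroup H] [InnerProductSpace ℝ H]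
  [NormedAddCommGroup H₂] [InnerProductSpace ℝ H₂]
  {T : H →L[ℝ] H} {lam : ℕ → ℝ} {v : ℕ → H}

@[simp]
theorem tensor_apply {H₁ : Type*} [NormedAddCommGroup H₁] [InnerProductSpace ℝ H₁]
    (x w : H₁) (y : H₂) : tensor x y w = ⟪x, w⟫_ℝ • y := rfl

@[simp]
theorem norm_tensor {H₁ : Type*} [NormedAddCommGroup H₁] [InnerProductSpace ℝ H₁]
    (x : H₁) (y : H₂) : ‖tensor x y‖ = ‖x‖ * ‖y‖ := by
  rw [tensor, InnerProductSpace.norm_rankOne, mul_comm]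

/-- `1 - ∑_{j < K} v_j ⊗ v_j`. -/
noncomputable def residual (v : ℕ → H) (K : ℕ) : H →L[ℝ] H :=
  ContinuousLinearMap.id ℝ H - ∑ j ∈ Finset.range K, tensor (v j) (v j)

theorem residual_apply (v : ℕ → H) (K : ℕ) (x : H) :
    residual v K x = x - ∑ j ∈ Finset.range K, ⟪v j, x⟫_ℝ • v j := by
  simp [residual]

theorem inner_residual_eq_zero (hv : Orthonormal ℝ v) {K i : ℕ} (hi : i < K) (x : H) :
    ⟪v i, residual v K x⟫_ℝ = 0 := by
  rw [residual_apply, inner_sub_right, hv.inner_right_sum _ (Finset.mem_range.2 hi), sub_self]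

theorem inner_residual_comm (v : ℕ → H) (K : ℕ) (x y : H) :
    ⟪residual v K x, y⟫_ℝ = ⟪x, residual v K y⟫_ℝ := by
  simp only [residual_apply, inner_sub_left, inner_sub_right, sum_inner, inner_sum,
    real_inner_smul_left, real_inner_smul_right, real_inner_comm x]
  congr 1
  exact Finset.sum_congr rfl fun i _ => mul_comm _ _

theorem norm_residual_apply_le (hv : Orthonormal ℝ v) (K : ℕ) (x : H) :
    ‖residual v K x‖ ≤ ‖x‖ := by
  have h1 : ⟪residual v K x, residual v K x⟫_ℝ = ⟪x, residual v K x⟫_ℝ := by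
    have h0 : ⟪∑ j ∈ Finset.range K, ⟪v j, x⟫_ℝ • v j, residual v K x⟫_ℝ = 0 := by
      rw [sum_inner]
      refine Finset.sum_eq_zero fun j hj => ?_
      rw [real_inner_smul_left, inner_residual_eq_zero hv (Finset.mem_range.1 hj), mul_zero]
    nth_rewrite 1 [residual_apply]
    rw [inner_sub_left, h0, sub_zero]
  have h2 := real_inner_le_norm x (residual v K x)
  rw [← h1, real_inner_self_eq_norm_sq, sq] at h2
  by_contra! h3
  have h4 : 0 < ‖residual v K x‖ := (norm_nonneg x).trans_lt h3
  exact absurd (le_of_mul_le_mul_right h2 h4) (not_le.2 h3)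

theorem IsEigenSystem.residual_apply_comm (h : IsEigenSystem T lam v) (hT : T.IsPositive)
    (K : ℕ) (x : H) : residual v K (T x) = T (residual v K x) := by
  simp only [residual_apply, map_sub, map_sum, map_smul, h.eigen]
  congr 1
  refine Finset.sum_congr rfl fun j _ => ?_
  have := hT.isSymmetric (v j) x
  simp only [ContinuousLinearMap.coe_coe] at this
  rw [← this, h.eigen, real_inner_smul_left, smul_smul, mul_comm]

/-- The residual commutes with `T`, and on its range, orthogonal to the first `K` eigenvectors, `T`
is bounded by `lam K`. Counting from `0`, this is the first discarded eigenvalue. -/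
theorem IsEigenSystem.norm_residual_apply_le [CompleteSpace H] (h : IsEigenSystem T lam v)
    (hT : T.IsPositive) (hc : IsCompactOperator T) (K : ℕ) (x : H) :
    ‖residual v K (T x)‖ ≤ lam K * ‖x‖ := by
  rw [h.residual_apply_comm hT]
  refine (h.norm_apply_le_of_orthogonal hT hc fun i hi =>
    inner_residual_eq_zero h.orthonormal hi x).trans ?_
  exact mul_le_mul_of_nonneg_left (HilbertLM.norm_residual_apply_le h.orthonormal K x)
    (h.nonneg hT K)

/-- Bias plus noise. One factor `m` bounds the inverse eigenvalues, the other the number of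
summands. -/
theorem norm_pcaOperator_sub_le (h : IsEigenSystem T lam v) (Ψ L : H →L[ℝ] H₂) {K : ℕ} {m : ℝ}
    (hKm : (K : ℝ) ≤ m) (hlam : ∀ j < K, 0 < lam j ∧ (lam j)⁻¹ ≤ m) :
    ‖pcaOperator (Ψ ∘L T + L) lam v K - Ψ‖ ≤ ‖Ψ ∘L residual v K‖ + m ^ 2 * ‖L‖ := by
  have hm : 0 ≤ m := (Nat.cast_nonneg K).trans hKm
  have e : pcaOperator (Ψ ∘L T + L) lam v K - Ψ =
      -(Ψ ∘L residual v K) + ∑ j ∈ Finset.range K, tensor (v j) ((lam j)⁻¹ • L (v j)) := by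
    ext x
    simp only [pcaOperator, _root_.sub_apply, _root_.add_apply,
      _root_.neg_apply, _root_.sum_apply, tensor_apply,
      ContinuousLinearMap.comp_apply, residual_apply, map_sub, map_sum, map_smul, h.eigen,
      smul_add, Finset.sum_add_distrib]
    rw [Finset.sum_congr rfl (g := fun j => ⟪v j, x⟫_ℝ • Ψ (v j)) fun j hj => by
      rw [inv_smul_smul₀ (hlam j (Finset.mem_range.1 hj)).1.ne']]
    abel
  rw [e]
  refine (norm_add_le _ _).trans ?_
  rw [norm_neg]
  gcongr
  calc ‖∑ j ∈ Finset.range K, tensor (v j) ((lam j)⁻¹ • L (v j))‖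
      ≤ ∑ j ∈ Finset.range K, m * ‖L‖ := by
        refine norm_sum_le_of_le _ fun j hj => ?_
        obtain ⟨h1, h2⟩ := hlam j (Finset.mem_range.1 hj)
        rw [norm_tensor, h.orthonormal.1, one_mul, norm_smul, norm_inv, Real.norm_eq_abs,
          abs_of_pos h1]
        gcongr
        simpa [h.orthonormal.1 j] using L.le_opNorm (v j)
    _ = K * (m * ‖L‖) := by simp
    _ ≤ m * (m * ‖L‖) := by gcongr
    _ = m ^ 2 * ‖L‖ := by ring

end Projection

/-! ### Composition of a Hilbert–Schmidt operator with the residual -/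

section HilbertSchmidt

variable {H₁ H₂ : Type*} [NormedAddCommGroup H₁] [InnerProductSpace ℝ H₁] [CompleteSpace H₁]
  [NormedAddCommGroup H₂] [InnerProductSpace ℝ H₂]

/-- Hilbert–Schmidt operators are limits of operators of finite rank. -/
theorem IsHilbertSchmidt.exists_norm_apply_sub_le {Ψ : H₁ →L[ℝ] H₂} (hΨ : IsHilbertSchmidt Ψ)
    {η : ℝ} (hη : 0 < η) :
    ∃ F : Finset H₁, ∀ x, ‖Ψ x - ∑ e ∈ F, ⟪e, x⟫_ℝ • Ψ e‖ ≤ η * ‖x‖ := by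
  classical
  obtain ⟨s, b, hb⟩ := exists_hilbertBasis ℝ H₁
  have hsum := hΨ s b
  obtain ⟨F, hF⟩ := (summable_iff_vanishing_norm.1 hsum) (η ^ 2) (by positivity)
  refine ⟨F.map ⟨Subtype.val, Subtype.val_injective⟩, fun x => ?_⟩
  have hx : HasSum (fun i => ⟪b i, x⟫_ℝ • Ψ (b i)) (Ψ x) := by
    have := (b.hasSum_repr x).mapL Ψ
    simpa [b.repr_apply_apply] using this
  have htends : Tendsto (fun G : Finset s => ‖∑ i ∈ G, ⟪b i, x⟫_ℝ • Ψ (b i)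
      - ∑ i ∈ F, ⟪b i, x⟫_ℝ • Ψ (b i)‖) atTop (𝓝 ‖Ψ x - ∑ i ∈ F, ⟪b i, x⟫_ℝ • Ψ (b i)‖) :=
    (Tendsto.sub_const hx _).norm
  rw [Finset.sum_map]
  simp only [Function.Embedding.coeFn_mk]
  rw [Finset.sum_congr rfl (g := fun i => ⟪b i, x⟫_ℝ • Ψ (b i)) fun i _ => by rw [hb]]
  -- On finite sets `G ⊇ F` the tail is estimated by Cauchy–Schwarz: the choice of `F` bounds one
  -- factor by `η`, Bessel's inequality the other by `‖x‖`.
  refine le_of_tendsto htends ((eventually_ge_atTop F).mono fun G hG => ?_)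
  rw [← Finset.sum_sdiff hG, add_sub_cancel_right]
  refine (norm_sum_le _ _).trans ?_
  simp only [norm_smul]
  refine (Real.sum_mul_le_sqrt_mul_sqrt _ _ _).trans ?_
  rw [mul_comm]
  gcongr
  · refine Real.sqrt_le_iff.2 ⟨hη.le, ?_⟩
    have := hF (G \ F) Finset.sdiff_disjoint
    rw [Real.norm_eq_abs] at this
    exact (le_abs_self _).trans this.le
  · refine Real.sqrt_le_iff.2 ⟨norm_nonneg _, ?_⟩
    exact b.orthonormal.sum_inner_products_le x

/-- If `C` has dense range, then a symmetric contraction `R` for which `R ∘ C'` is small for some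
`C'` close to `C` is small after composition with a Hilbert–Schmidt operator. -/
theorem IsHilbertSchmidt.exists_norm_comp_le {Ψ : H₁ →L[ℝ] H₂} (hΨ : IsHilbertSchmidt Ψ)
    {C : H₁ →L[ℝ] H₁} (hC : DenseRange C) {η : ℝ} (hη : 0 < η) :
    ∃ κ > 0, ∀ C' R : H₁ →L[ℝ] H₁, ‖C - C'‖ ≤ κ → (∀ x, ‖R x‖ ≤ ‖x‖) →
      (∀ x y, ⟪R x, y⟫_ℝ = ⟪x, R y⟫_ℝ) → (∀ x, ‖R (C' x)‖ ≤ κ * ‖x‖) → ‖Ψ ∘L R‖ ≤ η := by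
  obtain ⟨F, hF⟩ := hΨ.exists_norm_apply_sub_le (half_pos hη)
  set A : ℝ := ∑ e ∈ F, ‖Ψ e‖ with hA
  have hA0 : 0 ≤ A := Finset.sum_nonneg fun _ _ => norm_nonneg _
  set r : ℝ := η / (2 * (A + 1)) with hr
  have hr0 : 0 < r := by positivity
  have hz : ∀ e, ∃ z, ‖e - C z‖ < r / 2 := fun e => by
    obtain ⟨z, hz⟩ := hC.exists_dist_lt e (half_pos hr0)
    exact ⟨z, by rwa [dist_eq_norm] at hz⟩
  choose z hz using hz
  set B : ℝ := ∑ e ∈ F, ‖z e‖ with hB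
  have hB0 : 0 ≤ B := Finset.sum_nonneg fun _ _ => norm_nonneg _
  -- In the splitting `e = (e - C z) + (C - C') z + C' z`, the images under `R` cost `r / 2 + r / 4
  -- + r / 4`. The `+ 1` in `r` and `κ` avoids division by zero.
  refine ⟨r / (4 * (B + 1)), by positivity, fun C' R hCC' hR hsymm hRC' => ?_⟩
  set κ := r / (4 * (B + 1)) with hκ
  have hκ0 : 0 < κ := by positivity
  have hRe : ∀ e ∈ F, ‖R e‖ ≤ r := by
    intro e he
    have e1 : R e = R (e - C (z e)) + R ((C - C') (z e)) + R (C' (z e)) := by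
      rw [← map_add, ← map_add]; simp
    have e2 : ‖z e‖ ≤ B := Finset.single_le_sum (f := fun e => ‖z e‖)
      (fun _ _ => norm_nonneg _) he
    have e3 : ‖R ((C - C') (z e))‖ ≤ κ * ‖z e‖ :=
      (hR _).trans ((ContinuousLinearMap.le_opNorm _ _).trans (by gcongr))
    have e4 : κ * ‖z e‖ ≤ r / 4 := by
      calc κ * ‖z e‖ ≤ κ * (B + 1) := by gcongr; linarith
        _ = r / 4 := by rw [hκ]; field_simp
    have e5 := hRC' (z e)
    have e6 := (hR (e - C (z e))).trans (hz e).le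
    rw [e1]
    refine (norm_add₃_le).trans ?_
    linarith
  refine ContinuousLinearMap.opNorm_le_bound _ hη.le fun x => ?_
  have h1 := hF (R x)
  have h2 : ‖∑ e ∈ F, ⟪e, R x⟫_ℝ • Ψ e‖ ≤ ∑ e ∈ F, r * ‖x‖ * ‖Ψ e‖ := by
    refine norm_sum_le_of_le _ fun e he => ?_
    -- Symmetry moves `R` from the arbitrary `x` onto the finitely many fixed vectors `e`.
    rw [norm_smul, ← hsymm]
    gcongr
    exact (norm_inner_le_norm _ _).trans (by gcongr; exact hRe e he)
  rw [← Finset.mul_sum, ← hA] at h2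
  have h3 : r * A ≤ η / 2 := by
    calc r * A ≤ r * (A + 1) := by gcongr; linarith
      _ = η / 2 := by rw [hr]; field_simp
  have h4 : ‖Ψ (R x)‖ ≤ ‖Ψ (R x) - ∑ e ∈ F, ⟪e, R x⟫_ℝ • Ψ e‖ + ‖∑ e ∈ F, ⟪e, R x⟫_ℝ • Ψ e‖ := by
    simpa using norm_add_le (Ψ (R x) - ∑ e ∈ F, ⟪e, R x⟫_ℝ • Ψ e) (∑ e ∈ F, ⟪e, R x⟫_ℝ • Ψ e)
  have h5 : η / 2 * ‖R x‖ ≤ η / 2 * ‖x‖ := by gcongr; exact hR x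
  have h6 : r * A * ‖x‖ ≤ η / 2 * ‖x‖ := by gcongr
  rw [ContinuousLinearMap.comp_apply]
  nlinarith

end HilbertSchmidt

/-! ### Laws and independence of the innovation sequences -/

section Innovations

variable {Ω S : Type*} {δ δ' : ℤ → Ω → S}

/-- With `δ` and `δ'` merged into one family over `ℤ ⊕ ℤ`, questions about laws and independence
reduce to injectivity and disjointness of index maps. -/
theorem past_eq_elim (n : ℤ) :
    past δ n = fun ω (i : ℕ) => Sum.elim δ δ' (Sum.inl (n - i)) ω := rfl

theorem coupledPast_eq_elim (n : ℤ) (m : ℕ) :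
    coupledPast δ δ' n m = fun ω (i : ℕ) =>
      Sum.elim δ δ' (if i < m then Sum.inl (n - i) else Sum.inr (n - i)) ω := by
  ext ω i
  rw [coupledPast]
  split_ifs <;> rfl

variable [MeasurableSpace S]

theorem comap_elim_comp_le {ι : Type*} (φ : ι → ℤ ⊕ ℤ) :
    MeasurableSpace.comap (fun (ω : Ω) i => Sum.elim δ δ' (φ i) ω) MeasurableSpace.pi ≤
      ⨆ i ∈ Set.range φ, MeasurableSpace.comap (Sum.elim δ δ' i) inferInstance := by
  rw [MeasurableSpace.pi, MeasurableSpace.comap_iSup]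
  refine iSup_le fun i => ?_
  rw [MeasurableSpace.comap_comp]
  exact le_iSup₂_of_le (φ i) ⟨i, rfl⟩ le_rfl

variable [MeasurableSpace Ω] {P : Measure Ω}

theorem IsIIDWithCopy.measurable_elim (h : IsIIDWithCopy P δ δ') (i : ℤ ⊕ ℤ) :
    Measurable (Sum.elim δ δ' i) := by
  cases i with
  | inl i => exact h.measurable i
  | inr i => exact h.measurable_copy i

theorem IsIIDWithCopy.map_elim (h : IsIIDWithCopy P δ δ') (i : ℤ ⊕ ℤ) :
    P.map (Sum.elim δ δ' i) = P.map (δ 0) := by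
  cases i with
  | inl i => exact (h.identDistrib i).map_eq
  | inr i => exact (h.identDistrib_copy i).map_eq

/-- Subfamilies of the innovations indexed by the same type have the same law. -/
theorem IsIIDWithCopy.identDistrib_subfamily (h : IsIIDWithCopy P δ δ') {ι : Type*}
    {φ ψ : ι → ℤ ⊕ ℤ} (hφ : Function.Injective φ) (hψ : Function.Injective ψ) :
    IdentDistrib (fun ω i => Sum.elim δ δ' (φ i) ω) (fun ω i => Sum.elim δ δ' (ψ i) ω) P P where
  aemeasurable_fst := (measurable_pi_iff.2 fun i => h.measurable_elim (φ i)).aemeasurable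
  aemeasurable_snd := (measurable_pi_iff.2 fun i => h.measurable_elim (ψ i)).aemeasurable
  map_eq := by
    rw [(h.indep.precomp hφ).map_fun_eq_infinitePi_map fun i => h.measurable_elim (φ i),
      (h.indep.precomp hψ).map_fun_eq_infinitePi_map fun i => h.measurable_elim (ψ i)]
    simp only [h.map_elim]

/-- Disjoint subfamilies of the innovations are independent. -/
theorem IsIIDWithCopy.indepFun_subfamily (h : IsIIDWithCopy P δ δ') {ι κ : Type*}
    {φ : ι → ℤ ⊕ ℤ} {ψ : κ → ℤ ⊕ ℤ} (hd : ∀ i j, φ i ≠ ψ j) :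
    IndepFun (fun ω i => Sum.elim δ δ' (φ i) ω) (fun ω j => Sum.elim δ δ' (ψ j) ω) P := by
  have key := indep_iSup_of_disjoint (fun i => (h.measurable_elim i).comap_le)
    ((iIndepFun_iff_iIndep _ _ _).1 h.indep) (S := Set.range φ) (T := Set.range ψ)
    (Set.disjoint_left.2 fun _ ⟨i, hi⟩ ⟨j, hj⟩ => hd i j (hi.trans hj.symm))
  rw [IndepFun_iff_Indep]
  exact indep_of_indep_of_le_left
    (indep_of_indep_of_le_right key (comap_elim_comp_le ψ)) (comap_elim_comp_le φ)

theorem IsIIDWithCopy.measurable_past (h : IsIIDWithCopy P δ δ') (n : ℤ) :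
    Measurable (past δ n) := measurable_pi_iff.2 fun _ => h.measurable _

theorem IsIIDWithCopy.measurable_coupledPast (h : IsIIDWithCopy P δ δ') (n : ℤ) (m : ℕ) :
    Measurable (coupledPast δ δ' n m) := by
  rw [coupledPast_eq_elim]
  exact measurable_pi_iff.2 fun _ => h.measurable_elim _

theorem IsIIDWithCopy.identDistrib_past (h : IsIIDWithCopy P δ δ') (n k : ℤ) :
    IdentDistrib (past δ n) (past δ k) P P := by
  rw [past_eq_elim (δ' := δ'), past_eq_elim (δ' := δ')]
  exact h.identDistrib_subfamily (fun i j hij => by simpa using hij)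
    (fun i j hij => by simpa using hij)

theorem IsIIDWithCopy.identDistrib_coupledPast (h : IsIIDWithCopy P δ δ') (n : ℤ) (m : ℕ)
    (k : ℤ) : IdentDistrib (coupledPast δ δ' n m) (past δ k) P P := by
  rw [past_eq_elim (δ' := δ'), coupledPast_eq_elim]
  refine h.identDistrib_subfamily (fun i j hij => ?_) (fun i j hij => by simpa using hij)
  split_ifs at hij <;> simpa using hij

/-- From `δ` the coupled sequence uses only the indices `k + 1, …, k + m`, and the past at `k` only
those up to `k`. -/
theorem IsIIDWithCopy.indepFun_past_coupledPast (h : IsIIDWithCopy P δ δ') (k : ℤ) (m : ℕ) :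
    IndepFun (past δ k) (coupledPast δ δ' (k + m) m) P := by
  rw [past_eq_elim (δ' := δ'), coupledPast_eq_elim]
  refine h.indepFun_subfamily fun i j hij => ?_
  split_ifs at hij
  simp only [Sum.inl.injEq] at hij
  omega

/-- Each pair is the same measurable function of the innovations reindexed by `i ↦ s - i`, whose law
does not depend on `s`. -/
theorem IsIIDWithCopy.identDistrib_past_coupledPast (h : IsIIDWithCopy P δ δ') (n k : ℤ) (m : ℕ) :
    IdentDistrib (fun ω => (past δ n ω, coupledPast δ δ' n m ω))
      (fun ω => (past δ k ω, coupledPast δ δ' k m ω)) P P := by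
  have hs (s : ℤ) : Function.Injective (Sum.map (s - ·) (s - ·) : ℤ ⊕ ℤ → ℤ ⊕ ℤ) :=
    Function.Injective.sumMap (sub_right_injective) (sub_right_injective)
  have hu : Measurable fun d : ℤ ⊕ ℤ → S => ((fun i : ℕ => d (Sum.inl (i : ℤ))),
      fun i : ℕ => d (if i < m then Sum.inl (i : ℤ) else Sum.inr (i : ℤ))) := by
    fun_prop
  have e (s : ℤ) : (fun ω => (past δ s ω, coupledPast δ δ' s m ω)) =
      (fun d : ℤ ⊕ ℤ → S => ((fun i : ℕ => d (Sum.inl (i : ℤ))),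
        fun i : ℕ => d (if i < m then Sum.inl (i : ℤ) else Sum.inr (i : ℤ)))) ∘
      fun ω i => Sum.elim δ δ' (Sum.map (s - ·) (s - ·) i) ω := by
    ext ω i
    · rfl
    · simp only [coupledPast, Function.comp_apply]
      split_ifs <;> rfl
  rw [e, e]
  exact (h.identDistrib_subfamily (hs n) (hs k)).comp hu

end Innovations

/-! ### Transfer of moments along equality in law -/

section Transfer

variable {Ω S G : Type*} [MeasurableSpace Ω] [MeasurableSpace S] {P : Measure Ω}
  {δ δ' : ℤ → Ω → S} [NormedAddCommGroup G] {F : (ℕ → S) → G}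

theorem IsIIDWithCopy.memLp_past (h : IsIIDWithCopy P δ δ') (hF : StronglyMeasurable F)
    {p : ℝ≥0∞} {n : ℤ} (hp : MemLp (fun ω => F (past δ n ω)) p P) (k : ℤ) :
    MemLp (fun ω => F (past δ k ω)) p P := by
  borelize G
  exact ((h.identDistrib_past n k).comp hF.measurable).memLp_iff.1 hp

theorem IsIIDWithCopy.memLp_coupledPast (h : IsIIDWithCopy P δ δ') (hF : StronglyMeasurable F)
    {p : ℝ≥0∞} {n : ℤ} (hp : MemLp (fun ω => F (past δ n ω)) p P) (k : ℤ) (m : ℕ) :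
    MemLp (fun ω => F (coupledPast δ δ' k m ω)) p P := by
  borelize G
  exact ((h.identDistrib_coupledPast k m n).comp hF.measurable).memLp_iff.2 hp

theorem IsIIDWithCopy.eLpNorm_past (h : IsIIDWithCopy P δ δ') (hF : StronglyMeasurable F)
    (p : ℝ≥0∞) (n k : ℤ) :
    eLpNorm (fun ω => F (past δ n ω)) p P = eLpNorm (fun ω => F (past δ k ω)) p P := by
  borelize G
  exact ((h.identDistrib_past n k).comp hF.measurable).eLpNorm_eq p

theorem IsIIDWithCopy.eLpNorm_coupledPast (h : IsIIDWithCopy P δ δ') (hF : StronglyMeasurable F)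
    (p : ℝ≥0∞) (n : ℤ) (m : ℕ) (k : ℤ) :
    eLpNorm (fun ω => F (coupledPast δ δ' n m ω)) p P =
      eLpNorm (fun ω => F (past δ k ω)) p P := by
  borelize G
  exact ((h.identDistrib_coupledPast n m k).comp hF.measurable).eLpNorm_eq p

theorem IsIIDWithCopy.eLpNorm_past_sub_coupledPast (h : IsIIDWithCopy P δ δ')
    (hF : StronglyMeasurable F) (p : ℝ≥0∞) (n k : ℤ) (m : ℕ) :
    eLpNorm (fun ω => F (past δ n ω) - F (coupledPast δ δ' n m ω)) p P =
      eLpNorm (fun ω => F (past δ k ω) - F (coupledPast δ δ' k m ω)) p P := by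
  borelize G
  have hu : Measurable fun q : (ℕ → S) × (ℕ → S) => F q.1 - F q.2 :=
    ((hF.comp_measurable measurable_fst).sub (hF.comp_measurable measurable_snd)).measurable
  exact ((h.identDistrib_past_coupledPast n k m).comp hu).eLpNorm_eq p

theorem IsIIDWithCopy.integral_past [NormedSpace ℝ G] (h : IsIIDWithCopy P δ δ')
    (hF : StronglyMeasurable F) (n k : ℤ) : ∫ ω, F (past δ n ω) ∂P = ∫ ω, F (past δ k ω) ∂P := by
  borelize G
  exact ((h.identDistrib_past n k).comp hF.measurable).integral_eq

end Transfer

/-! ### Variance of partial sums of Bernoulli shifts -/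

section SecondMoment

variable {Ω G : Type*} [MeasurableSpace Ω] {P : Measure Ω}
  [NormedAddCommGroup G] [InnerProductSpace ℝ G]

theorem integrable_inner_of_memLp {U V : Ω → G} (hU : MemLp U 2 P) (hV : MemLp V 2 P) :
    Integrable (fun ω => ⟪U ω, V ω⟫_ℝ) P :=
  memLp_one_iff_integrable.1 <| MemLp.of_bilin (fun x y => ⟪x, y⟫_ℝ) 1 hU hV
    (hU.1.inner hV.1) (ae_of_all _ fun ω => by simpa using nnnorm_inner_le_nnnorm (U ω) (V ω))

theorem abs_integral_inner_le {U V : Ω → G} (hU : MemLp U 2 P) (hV : MemLp V 2 P) :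
    |∫ ω, ⟪U ω, V ω⟫_ℝ ∂P| ≤ (eLpNorm U 2 P).toReal * (eLpNorm V 2 P).toReal := by
  have h1 : eLpNorm (fun ω => ⟪U ω, V ω⟫_ℝ) 1 P ≤ (1 : NNReal) * eLpNorm U 2 P * eLpNorm V 2 P :=
    eLpNorm_le_eLpNorm_mul_eLpNorm_of_nnnorm hU.1 hV.1 (fun x y => ⟪x, y⟫_ℝ) 1
      (ae_of_all _ fun ω => by simpa using nnnorm_inner_le_nnnorm (U ω) (V ω))
  have h2 : ‖∫ ω, ⟪U ω, V ω⟫_ℝ ∂P‖ ≤ (eLpNorm (fun ω => ⟪U ω, V ω⟫_ℝ) 1 P).toReal := by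
    rw [eLpNorm_one_eq_lintegral_enorm]
    refine (norm_integral_le_lintegral_norm _).trans_eq ?_
    simp only [ofReal_norm]
  refine h2.trans ?_
  rw [← ENNReal.toReal_mul]
  refine ENNReal.toReal_mono (ENNReal.mul_ne_top hU.2.ne hV.2.ne) (by simpa using h1)

variable {S : Type*} [MeasurableSpace S] {δ δ' : ℤ → Ω → S} [CompleteSpace G]
  [IsProbabilityMeasure P] {F : (ℕ → S) → G}

/-- The autocovariances of a centred Bernoulli shift are controlled by its coupling errors. -/
theorem IsIIDWithCopy.abs_integral_inner_past_le (h : IsIIDWithCopy P δ δ')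
    (hF : StronglyMeasurable F) (h2 : MemLp (fun ω => F (past δ 0 ω)) 2 P)
    (h0 : ∫ ω, F (past δ 0 ω) ∂P = 0) (k : ℤ) (m : ℕ) :
    |∫ ω, ⟪F (past δ k ω), F (past δ (k + m) ω)⟫_ℝ ∂P| ≤
      (eLpNorm (fun ω => F (past δ 0 ω)) 2 P).toReal *
      (eLpNorm (fun ω => F (past δ m ω) - F (coupledPast δ δ' m m ω)) 2 P).toReal := by
  have hk := h.memLp_past hF h2 k
  have hkm := h.memLp_past hF h2 (k + m)
  have hc := h.memLp_coupledPast hF h2 (k + m) m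
  -- The coupled variable is independent of the centred one at time `k`, so subtracting it leaves
  -- the covariance unchanged and only the coupling error remains.
  have e1 : ∫ ω, ⟪F (past δ k ω), F (coupledPast δ δ' (k + m) m ω)⟫_ℝ ∂P = 0 := by
    have : ∫ ω, ⟪F (past δ k ω), F (coupledPast δ δ' (k + m) m ω)⟫_ℝ ∂P =
        ⟪∫ ω, F (past δ k ω) ∂P, ∫ ω, F (coupledPast δ δ' (k + m) m ω) ∂P⟫_ℝ :=
      (h.indepFun_past_coupledPast k m).integral_bilin_comp_comp
      (f := F) (g := F) (h.measurable_past k).aemeasurable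
      (h.measurable_coupledPast (k + m) m).aemeasurable
      ((integrable_map_measure hF.aestronglyMeasurable (h.measurable_past k).aemeasurable).2
        (hk.integrable one_le_two))
      ((integrable_map_measure hF.aestronglyMeasurable
        (h.measurable_coupledPast (k + m) m).aemeasurable).2 (hc.integrable one_le_two))
      (innerSL ℝ)
    rw [this, h.integral_past hF k 0, h0, inner_zero_left]
  have e2 : ∫ ω, ⟪F (past δ k ω), F (past δ (k + m) ω)⟫_ℝ ∂P =
      ∫ ω, ⟪F (past δ k ω), F (past δ (k + m) ω) - F (coupledPast δ δ' (k + m) m ω)⟫_ℝ ∂P := by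
    simp only [inner_sub_right]
    rw [integral_sub (integrable_inner_of_memLp hk hkm) (integrable_inner_of_memLp hk hc), e1, sub_zero]
  rw [e2, h.eLpNorm_past hF 2 0 k, h.eLpNorm_past_sub_coupledPast hF 2 m (k + m) m]
  exact abs_integral_inner_le hk (hkm.sub hc)

/-- For fixed `k` each distance occurs at most once among `l ≥ k` and at most once among `l < k`. -/
theorem sum_sum_dist_le {a : ℕ → ℝ} (ha : ∀ m, 0 ≤ a m) (hs : Summable a) (n : ℕ) :
    ∑ k ∈ Finset.Icc 1 n, ∑ l ∈ Finset.Icc 1 n, a (Nat.dist k l) ≤ n * (2 * ∑' m, a m) := by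
  have h (k : ℕ) : ∑ l ∈ Finset.Icc 1 n, a (Nat.dist k l) ≤ 2 * ∑' m, a m := by
    rw [← Finset.sum_filter_add_sum_filter_not _ (fun l => k ≤ l), two_mul]
    refine add_le_add ?_ ?_
    · rw [← Finset.sum_image (f := a) (g := fun l => Nat.dist k l)]
      · exact hs.sum_le_tsum _ fun i _ => ha i
      · intro x hx y hy hxy
        simp only [Finset.coe_filter, Set.mem_ofPred_eq, Nat.dist] at hx hy hxy
        omega
    · rw [← Finset.sum_image (f := a) (g := fun l => Nat.dist k l)]
      · exact hs.sum_le_tsum _ fun i _ => ha i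
      · intro x hx y hy hxy
        simp only [Finset.coe_filter, Set.mem_ofPred_eq, Nat.dist] at hx hy hxy
        omega
  refine (Finset.sum_le_sum fun k _ => h k).trans_eq ?_
  simp

/-- Partial sums of a centred square integrable Bernoulli shift with summable coupling errors
have variance of order `n`. -/
theorem IsIIDWithCopy.exists_integral_norm_sum_sq_le (h : IsIIDWithCopy P δ δ')
    (hF : StronglyMeasurable F) (h2 : MemLp (fun ω => F (past δ 0 ω)) 2 P)
    (h0 : ∫ ω, F (past δ 0 ω) ∂P = 0)
    (hs : Summable fun m : ℕ =>
      (eLpNorm (fun ω => F (past δ m ω) - F (coupledPast δ δ' m m ω)) 2 P).toReal) :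
    ∃ c : ℝ, ∀ n : ℕ, ∫ ω, ‖∑ k ∈ Finset.Icc 1 n, F (past δ k ω)‖ ^ 2 ∂P ≤ n * c := by
  set A := (eLpNorm (fun ω => F (past δ 0 ω)) 2 P).toReal with hA
  set b : ℕ → ℝ := fun m : ℕ =>
      (eLpNorm (fun ω => F (past δ m ω) - F (coupledPast δ δ' m m ω)) 2 P).toReal with hb
  have hmem := h.memLp_past hF h2
  have hcov (k l : ℕ) : ∫ ω, ⟪F (past δ k ω), F (past δ l ω)⟫_ℝ ∂P ≤
      A * b (Nat.dist k l) := by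
    wlog hkl : k ≤ l generalizing k l
    · simp only [real_inner_comm (F (past δ l _)), Nat.dist_comm k]
      exact this l k (le_of_not_ge hkl)
    obtain ⟨m, rfl⟩ := Nat.exists_eq_add_of_le hkl
    have := (le_abs_self _).trans (h.abs_integral_inner_past_le hF h2 h0 k m)
    have hd : Nat.dist k (k + m) = m := by simp [Nat.dist]
    rw [hd, Nat.cast_add]
    exact this
  refine ⟨2 * ∑' m, A * b m, fun n => ?_⟩
  have hInt (k l : ℕ) : Integrable (fun ω => ⟪F (past δ k ω), F (past δ l ω)⟫_ℝ) P :=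
    integrable_inner_of_memLp (hmem k) (hmem l)
  calc ∫ ω, ‖∑ k ∈ Finset.Icc 1 n, F (past δ k ω)‖ ^ 2 ∂P
      = ∑ k ∈ Finset.Icc 1 n, ∑ l ∈ Finset.Icc 1 n,
          ∫ ω, ⟪F (past δ k ω), F (past δ l ω)⟫_ℝ ∂P := by
        simp only [← real_inner_self_eq_norm_sq, sum_inner, inner_sum]
        rw [integral_finsetSum _ fun k _ => integrable_finsetSum _ fun l _ => hInt _ _]
        refine Finset.sum_congr rfl fun k _ => ?_
        rw [integral_finsetSum _ fun l _ => hInt _ _]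
        exact Finset.sum_congr rfl fun l _ =>
          integral_congr_ae (ae_of_all _ fun ω => real_inner_comm _ _)
    _ ≤ ∑ k ∈ Finset.Icc 1 n, ∑ l ∈ Finset.Icc 1 n, A * b (Nat.dist k l) :=
        Finset.sum_le_sum fun k _ => Finset.sum_le_sum fun l _ => hcov k l
    _ ≤ n * (2 * ∑' m, A * b m) :=
        sum_sum_dist_le (a := fun m => A * b m)
          (fun m => mul_nonneg ENNReal.toReal_nonneg ENNReal.toReal_nonneg) (hs.mul_left A) n

end SecondMoment

/-! ### The Hilbert tensor product and its map to operators -/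

section HilbertTensor

variable {H₁ H₂ : Type*} [NormedAddCommGroup H₁] [InnerProductSpace ℝ H₁]
  [NormedAddCommGroup H₂] [InnerProductSpace ℝ H₂]

variable (H₁ H₂) in
/-- The Hilbert space tensor product of `H₁` and `H₂`. -/
abbrev HilbertTensor : Type _ := UniformSpace.Completion (H₁ ⊗[ℝ] H₂)

/-- The elementary tensor of `x` and `y` in the Hilbert space tensor product. -/
noncomputable def elemTensor (x : H₁) (y : H₂) : HilbertTensor H₁ H₂ :=
  ((x ⊗ₜ[ℝ] y : H₁ ⊗[ℝ] H₂) : UniformSpace.Completion (H₁ ⊗[ℝ] H₂))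

theorem norm_elemTensor (x : H₁) (y : H₂) : ‖elemTensor x y‖ = ‖x‖ * ‖y‖ := by
  rw [elemTensor, UniformSpace.Completion.norm_coe, TensorProduct.norm_tmul]

theorem continuous_elemTensor : Continuous fun q : H₁ × H₂ => elemTensor q.1 q.2 :=
  (UniformSpace.Completion.continuous_coe _).comp TensorProduct.continuous_tmul

/-- Reduces the coupling error of a product to the errors of its factors. -/
theorem elemTensor_sub_elemTensor (x x' : H₁) (y y' : H₂) :
    elemTensor x y - elemTensor x' y' = elemTensor x (y - y') + elemTensor (x - x') y' := by
  simp only [elemTensor, ← UniformSpace.Completion.coe_sub, ← UniformSpace.Completion.coe_add]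
  congr 1
  rw [TensorProduct.tmul_sub, TensorProduct.sub_tmul]
  abel

variable (H₁ H₂) in
/-- The linear map from the algebraic tensor product to operators sending `x ⊗ₜ y` to
`tensor x y`. -/
noncomputable def tensorToOperator : H₁ ⊗[ℝ] H₂ →ₗ[ℝ] H₁ →L[ℝ] H₂ :=
  TensorProduct.lift <| LinearMap.mk₂ ℝ tensor
    (fun x x' y => by ext; simp [inner_add_left, add_smul])
    (fun c x y => by ext; simp [real_inner_smul_left, smul_smul])
    (fun x y y' => by ext; simp)
    (fun c x y => by ext; simp [smul_smul, mul_comm])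

theorem tensorToOperator_apply_apply (z : H₁ ⊗[ℝ] H₂) (w : H₁) :
    tensorToOperator H₁ H₂ z w =
      TensorProduct.lid ℝ H₂ ((innerSL ℝ w).rTensor H₂ z) := by
  induction z using TensorProduct.induction_on with
  | zero => simp
  | tmul x y => simp [tensorToOperator, real_inner_comm]
  | add z z' hz hz' => rw [map_add, map_add, map_add, _root_.add_apply, hz, hz']

/-- Evaluation at `w` contracts the first factor of `z` with a functional of norm `‖w‖`. Second
moment bounds in the tensor product thereby pass to the operator norm. -/
theorem norm_tensorToOperator_le (z : H₁ ⊗[ℝ] H₂) : ‖tensorToOperator H₁ H₂ z‖ ≤ ‖z‖ := by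
  refine ContinuousLinearMap.opNorm_le_bound _ (norm_nonneg z) fun w => ?_
  rw [tensorToOperator_apply_apply, TensorProduct.norm_lid, mul_comm]
  refine (ContinuousLinearMap.le_opNorm _ _).trans ?_
  gcongr
  exact (ContinuousLinearMap.norm_rTensor_le _ _).trans_eq (innerSL_apply_norm ℝ w)

variable [CompleteSpace H₂]

variable (H₁ H₂) in
/-- The continuous extension of `tensorToOperator` to the Hilbert space tensor product. -/
noncomputable def hilbertTensorToOperator : HilbertTensor H₁ H₂ →L[ℝ] H₁ →L[ℝ] H₂ :=
  (tensorToOperator H₁ H₂).extendOfNorm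
    (UniformSpace.Completion.toComplₗᵢ (𝕜 := ℝ) (E := H₁ ⊗[ℝ] H₂)).toLinearMap

theorem hilbertTensorToOperator_elemTensor (x : H₁) (y : H₂) :
    hilbertTensorToOperator H₁ H₂ (elemTensor x y) = tensor x y := by
  refine (LinearMap.extendOfNorm_eq (UniformSpace.Completion.denseRange_coe)
    ⟨1, fun z => ?_⟩ (x ⊗ₜ[ℝ] y)).trans ?_
  · simpa using norm_tensorToOperator_le z
  · simp [tensorToOperator]

theorem norm_hilbertTensorToOperator_apply_le (z : HilbertTensor H₁ H₂) :
    ‖hilbertTensorToOperator H₁ H₂ z‖ ≤ ‖z‖ := by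
  refine (LinearMap.norm_extendOfNorm_apply_le (UniformSpace.Completion.denseRange_coe) 1
    (fun z => ?_) z).trans_eq (one_mul _)
  simpa using norm_tensorToOperator_le z

end HilbertTensor

/-! ### Consequences of approximability -/

section Approximable

variable {Ω E S : Type*} [MeasurableSpace Ω] [MeasurableSpace S]
  [NormedAddCommGroup E] [MeasurableSpace E]
  {P : Measure Ω} {δ δ' : ℤ → Ω → S} {f : (ℕ → S) → E} {X : ℕ → Ω → E}

theorem IsLpmApproximable.tsum_ne_top {p : ℝ≥0∞} (hX : IsLpmApproximable P p δ δ' f X) :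
    ∑' i : ℕ, eLpNorm (fun ω => f (past δ ((i + 1 : ℕ) : ℤ) ω) -
      f (coupledPast δ δ' ((i + 1 : ℕ) : ℤ) (i + 1) ω)) p P ≠ ∞ := by
  refine ne_of_lt (lt_of_eq_of_lt (tsum_congr fun i => eLpNorm_congr_ae ?_) hX.summable)
  filter_upwards [hX.repr (i + 1) (by omega)] with ω hω
  rw [hω]

variable [TopologicalSpace.SeparableSpace E] [BorelSpace E]

theorem IsLpmApproximable.stronglyMeasurable {p : ℝ≥0∞} (hX : IsLpmApproximable P p δ δ' f X) :
    StronglyMeasurable f := by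
  have := UniformSpace.secondCountable_of_separable E
  exact hX.measurable.stronglyMeasurable

theorem IsLpmApproximable.memLp_past {p : ℝ≥0∞} (hX : IsLpmApproximable P p δ δ' f X)
    (hδ : IsIIDWithCopy P δ δ') (k : ℤ) : MemLp (fun ω => f (past δ k ω)) p P := by
  refine hδ.memLp_past hX.stronglyMeasurable (n := 1) ?_ k
  refine (memLp_congr_ae ?_).1 (hX.memLp 1 le_rfl)
  have h1 := hX.repr 1 le_rfl
  rw [Nat.cast_one] at h1
  exact h1

end Approximable

/-! ### Root-n consistency of empirical cross moments -/

section CrossMoment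

variable {Ω H₁ H₂ S : Type*} [MeasurableSpace Ω]
  [NormedAddCommGroup H₁] [InnerProductSpace ℝ H₁]
  [NormedAddCommGroup H₂] [InnerProductSpace ℝ H₂] {P : Measure Ω}

/-- Hölder with `1/4 + 1/4 = 1/2`: fourth moments of the factors give second moments of the product.
-/
theorem eLpNorm_elemTensor_le {x : Ω → H₁} {y : Ω → H₂} (hx : AEStronglyMeasurable x P)
    (hy : AEStronglyMeasurable y P) :
    eLpNorm (fun ω => elemTensor (x ω) (y ω)) 2 P ≤ eLpNorm x 4 P * eLpNorm y 4 P := by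
  have : ENNReal.HolderTriple 4 4 2 := ⟨by
    rw [← two_mul, show (4 : ℝ≥0∞) = 2 * 2 by norm_num,
      ENNReal.mul_inv (by simp) (by simp), ← mul_assoc,
      ENNReal.mul_inv_cancel (by simp) (by simp), one_mul]⟩
  simpa using eLpNorm_le_eLpNorm_mul_eLpNorm'_of_norm hx hy elemTensor 1
    (ae_of_all _ fun ω => by simp [norm_elemTensor])

variable [MeasurableSpace S]
  [TopologicalSpace.SeparableSpace H₁] [MeasurableSpace H₁] [BorelSpace H₁]
  [TopologicalSpace.SeparableSpace H₂] [MeasurableSpace H₂] [BorelSpace H₂]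
  {δ δ' : ℤ → Ω → S}
  {f : (ℕ → S) → H₁} {X : ℕ → Ω → H₁} {g : (ℕ → S) → H₂} {Y : ℕ → Ω → H₂}

/-- The coupling errors of products are summable. -/
theorem summable_eLpNorm_elemTensor_sub (hδ : IsIIDWithCopy P δ δ')
    (hX : IsLpmApproximable P 4 δ δ' f X) (hY : IsLpmApproximable P 4 δ δ' g Y) :
    Summable fun m : ℕ => (eLpNorm (fun ω => elemTensor (f (past δ m ω)) (g (past δ m ω)) -
      elemTensor (f (coupledPast δ δ' m m ω)) (g (coupledPast δ δ' m m ω))) 2 P).toReal := by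
  -- The approximability series starts at `m = 1`, so the term `m = 0` is dropped.
  rw [← summable_nat_add_iff 1]
  refine ENNReal.summable_toReal ?_
  have hf := hX.stronglyMeasurable
  have hg := hY.stronglyMeasurable
  have hp (k : ℤ) := hδ.measurable_past k
  have hc (k : ℤ) (m : ℕ) := hδ.measurable_coupledPast k m
  set A := eLpNorm (fun ω => f (past δ 0 ω)) 4 P with hA
  set B := eLpNorm (fun ω => g (past δ 0 ω)) 4 P with hB
  have hA' : A ≠ ∞ := (hX.memLp_past hδ 0).2.ne
  have hB' : B ≠ ∞ := (hY.memLp_past hδ 0).2.ne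
  refine ne_top_of_le_ne_top ?_ (ENNReal.tsum_le_tsum (g := fun i : ℕ =>
    A * eLpNorm (fun ω => g (past δ ((i + 1 : ℕ) : ℤ) ω) -
      g (coupledPast δ δ' ((i + 1 : ℕ) : ℤ) (i + 1) ω)) 4 P +
    eLpNorm (fun ω => f (past δ ((i + 1 : ℕ) : ℤ) ω) -
      f (coupledPast δ δ' ((i + 1 : ℕ) : ℤ) (i + 1) ω)) 4 P * B) fun i => ?_)
  · rw [ENNReal.tsum_add, ENNReal.tsum_mul_left, ENNReal.tsum_mul_right]
    exact ENNReal.add_ne_top.2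
      ⟨ENNReal.mul_ne_top hA' hY.tsum_ne_top, ENNReal.mul_ne_top hX.tsum_ne_top hB'⟩
  · simp only [elemTensor_sub_elemTensor]
    have mf := (hf.comp_measurable (hp (i + 1 : ℕ))).aestronglyMeasurable (μ := P)
    have mg := (hg.comp_measurable (hp (i + 1 : ℕ))).aestronglyMeasurable (μ := P)
    have mf' := (hf.comp_measurable (hc (i + 1 : ℕ) (i + 1))).aestronglyMeasurable (μ := P)
    have mg' := (hg.comp_measurable (hc (i + 1 : ℕ) (i + 1))).aestronglyMeasurable (μ := P)
    refine (eLpNorm_add_le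
      (continuous_elemTensor.comp_aestronglyMeasurable (mf.prodMk (mg.sub mg')))
      (continuous_elemTensor.comp_aestronglyMeasurable ((mf.sub mf').prodMk mg'))
      one_le_two).trans ?_
    rw [hA, hB, hδ.eLpNorm_past hf 4 0 (i + 1 : ℕ),
      ← hδ.eLpNorm_coupledPast hg 4 (i + 1 : ℕ) (i + 1) 0]
    exact add_le_add (eLpNorm_elemTensor_le mf (mg.sub mg'))
      (eLpNorm_elemTensor_le (mf.sub mf') mg')

variable [IsProbabilityMeasure P] [CompleteSpace H₂]

/-- The empirical cross moment operator is consistent with rate `n ^ (1 / 2)`. -/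
theorem tendsto_measure_empCrossMoment_sub (hδ : IsIIDWithCopy P δ δ')
    (hX : IsLpmApproximable P 4 δ δ' f X) (hY : IsLpmApproximable P 4 δ δ' g Y)
    {b : ℕ → ℝ} (hb : (fun n => b n ^ 2) =o[atTop] fun n => (n : ℝ)) {η : ℝ} (hη : 0 < η) :
    Tendsto (fun n => P {ω | η ≤ b n * ‖empCrossMoment X Y n ω - crossMoment P (X 1) (Y 1)‖})
      atTop (𝓝 0) := by
  have hf := hX.stronglyMeasurable
  have hg := hY.stronglyMeasurable
  set F₀ : (ℕ → S) → HilbertTensor H₁ H₂ := fun q => elemTensor (f q) (g q) with hF₀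
  set μ := ∫ ω, F₀ (past δ 0 ω) ∂P with hμ
  set F : (ℕ → S) → HilbertTensor H₁ H₂ := fun q => F₀ q - μ with hFdef
  have hF₀m : StronglyMeasurable F₀ :=
    continuous_elemTensor.comp_stronglyMeasurable (hf.prodMk hg)
  have hFm : StronglyMeasurable F := hF₀m.sub stronglyMeasurable_const
  have h2₀ : MemLp (fun ω => F₀ (past δ 0 ω)) 2 P :=
    ⟨(hF₀m.comp_measurable (hδ.measurable_past 0)).aestronglyMeasurable,
      (eLpNorm_elemTensor_le (hX.memLp_past hδ 0).1 (hY.memLp_past hδ 0).1).trans_lt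
        (ENNReal.mul_lt_top (hX.memLp_past hδ 0).2 (hY.memLp_past hδ 0).2)⟩
  have h2 : MemLp (fun ω => F (past δ 0 ω)) 2 P := h2₀.sub (memLp_const μ)
  have h0 : ∫ ω, F (past δ 0 ω) ∂P = 0 := by
    rw [integral_sub (h2₀.integrable one_le_two) (integrable_const μ)]
    simp [hμ]
  have hs : Summable fun m : ℕ =>
      (eLpNorm (fun ω => F (past δ m ω) - F (coupledPast δ δ' m m ω)) 2 P).toReal := by
    simpa only [hFdef, sub_sub_sub_cancel_right] using summable_eLpNorm_elemTensor_sub hδ hX hY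
  obtain ⟨c, hc⟩ := hδ.exists_integral_norm_sum_sq_le hFm h2 h0 hs
  have hmean : crossMoment P (X 1) (Y 1) = hilbertTensorToOperator H₁ H₂ μ := by
    rw [hμ, ← hδ.integral_past hF₀m 1 0, ← ContinuousLinearMap.integral_comp_comm _
      ((hδ.memLp_past hF₀m h2₀ 1).integrable one_le_two), crossMoment]
    refine integral_congr_ae ?_
    filter_upwards [hX.repr 1 le_rfl, hY.repr 1 le_rfl] with ω h1 h2
    rw [hF₀, hilbertTensorToOperator_elemTensor, h1, h2]
    simp
  have hrepr : ∀ᵐ ω ∂P, ∀ k : ℕ, 1 ≤ k → X k ω = f (past δ k ω) ∧ Y k ω = g (past δ k ω) := by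
    rw [ae_all_iff]
    intro k
    by_cases hk : 1 ≤ k
    · filter_upwards [hX.repr k hk, hY.repr k hk] with ω h1 h2 _ using ⟨h1, h2⟩
    · exact ae_of_all _ fun ω h => absurd h hk
  have hnorm (n : ℕ) (hn : 1 ≤ n) : ∀ᵐ ω ∂P,
      ‖empCrossMoment X Y n ω - crossMoment P (X 1) (Y 1)‖ ≤
        (n : ℝ)⁻¹ * ‖∑ k ∈ Finset.Icc 1 n, F (past δ k ω)‖ := by
    filter_upwards [hrepr] with ω hω
    have hn0 : (n : ℝ) ≠ 0 := by positivity
    have e : empCrossMoment X Y n ω - crossMoment P (X 1) (Y 1) =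
        hilbertTensorToOperator H₁ H₂ ((n : ℝ)⁻¹ • ∑ k ∈ Finset.Icc 1 n, F (past δ k ω)) := by
      simp only [hFdef, Finset.sum_sub_distrib, Finset.sum_const, Nat.card_Icc,
        Nat.add_sub_cancel, smul_sub, map_sub, map_smul, map_sum, hF₀,
        hilbertTensorToOperator_elemTensor, hmean, empCrossMoment]
      congr 1
      · refine congrArg _ (Finset.sum_congr rfl fun k hk => ?_)
        obtain ⟨h1, h2⟩ := hω k (Finset.mem_Icc.1 hk).1
        rw [h1, h2]
      · rw [map_nsmul, ← Nat.cast_smul_eq_nsmul ℝ, smul_smul, inv_mul_cancel₀ hn0, one_smul]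
    rw [e]
    refine (norm_hilbertTensorToOperator_apply_le _).trans_eq ?_
    rw [norm_smul, norm_inv, Real.norm_natCast]
  -- Markov's inequality for the squared norm: the variance bound `n * c`, scaled by `(b n / n) ^
  -- 2`, is `b n ^ 2 / n * c`.
  have hbound (n : ℕ) (hn : 1 ≤ n) :
      P {ω | η ≤ b n * ‖empCrossMoment X Y n ω - crossMoment P (X 1) (Y 1)‖} ≤
        ENNReal.ofReal (b n ^ 2 / n * (c / η ^ 2)) := by
    have hn0 : (0 : ℝ) < n := by positivity
    set Z : Ω → ℝ := fun ω => (b n / n) ^ 2 * ‖∑ k ∈ Finset.Icc 1 n, F (past δ k ω)‖ ^ 2 with hZ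
    have hmem : MemLp (fun ω => ∑ k ∈ Finset.Icc 1 n, F (past δ k ω)) 2 P :=
      memLp_finsetSum _ fun k _ => hδ.memLp_past hFm h2 k
    have hZi : Integrable Z P := (hmem.integrable_norm_pow two_ne_zero).const_mul _
    have hmono : P {ω | η ≤ b n * ‖empCrossMoment X Y n ω - crossMoment P (X 1) (Y 1)‖} ≤
        P {ω | η ^ 2 ≤ Z ω} := by
      refine measure_mono_ae ?_
      filter_upwards [hnorm n hn] with ω hω (hle : η ≤ _)
      change η ^ 2 ≤ Z ω
      have h1 : η ≤ |b n| * ((n : ℝ)⁻¹ * ‖∑ k ∈ Finset.Icc 1 n, F (past δ k ω)‖) :=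
        hle.trans (mul_le_mul (le_abs_self _) hω (norm_nonneg _) (abs_nonneg _))
      calc η ^ 2 ≤ (|b n| * ((n : ℝ)⁻¹ * ‖∑ k ∈ Finset.Icc 1 n, F (past δ k ω)‖)) ^ 2 := by
            gcongr
        _ = Z ω := by rw [hZ]; simp only [mul_pow, sq_abs, div_pow, inv_pow]; ring
    have hmarkov := mul_meas_ge_le_integral_of_nonneg
      (ae_of_all P fun ω => (by positivity : 0 ≤ Z ω)) hZi (η ^ 2)
    refine hmono.trans ?_
    rw [← ofReal_measureReal]
    refine ENNReal.ofReal_le_ofReal ?_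
    have hZc : ∫ ω, Z ω ∂P ≤ b n ^ 2 / n * c := by
      rw [hZ, integral_const_mul]
      calc (b n / n) ^ 2 * _ ≤ (b n / n) ^ 2 * (n * c) := by gcongr; exact hc n
        _ = b n ^ 2 / n * c := by field_simp
    rw [← mul_div_assoc, le_div_iff₀ (by positivity), mul_comm]
    exact hmarkov.trans hZc
  have hlim : Tendsto (fun n : ℕ => ENNReal.ofReal (b n ^ 2 / n * (c / η ^ 2))) atTop (𝓝 0) := by
    have := (hb.tendsto_div_nhds_zero).mul_const (c / η ^ 2)
    rw [zero_mul] at this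
    simpa using ENNReal.tendsto_ofReal this
  exact tendsto_of_tendsto_of_tendsto_of_le_of_le' tendsto_const_nhds hlim
    (Eventually.of_forall fun _ => zero_le) ((eventually_ge_atTop 1).mono hbound)

end CrossMoment

/-! ### Compactness and positivity of covariance operators -/

section Covariance

variable {Ω H₁ H₂ : Type*}
  [NormedAddCommGroup H₁] [InnerProductSpace ℝ H₁]
  [NormedAddCommGroup H₂] [InnerProductSpace ℝ H₂]

theorem isCompactOperator_tensor (x : H₁) (y : H₂) : IsCompactOperator (tensor x y) :=
  (isCompactOperator_of_locallyCompactSpace_dom (innerSL ℝ x)).clm_comp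
    (ContinuousLinearMap.toSpanSingleton ℝ y)

theorem isPositive_tensor_self (x : H₁) : (tensor x x).IsPositive :=
  InnerProductSpace.isPositive_rankOne_self x

theorem continuous_tensor : Continuous fun q : H₁ × H₂ => tensor q.1 q.2 :=
  (ContinuousLinearMap.smulRightL ℝ H₁ H₂).continuous₂.comp
    (((innerSL ℝ).continuous.comp continuous_fst).prodMk continuous_snd)

theorem isCompactOperator_empCrossMoment (X : ℕ → Ω → H₁) (Y : ℕ → Ω → H₂) (n : ℕ) (ω : Ω) :
    IsCompactOperator (empCrossMoment X Y n ω) :=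
  (compactOperator (RingHom.id ℝ) H₁ H₂).smul_mem _
    (Submodule.sum_mem _ fun k _ => isCompactOperator_tensor (X k ω) (Y k ω))

theorem isPositive_empCrossMoment_self (X : ℕ → Ω → H₁) (n : ℕ) (ω : Ω) :
    (empCrossMoment X X n ω).IsPositive :=
  (ContinuousLinearMap.isPositive_sum _ fun k _ => isPositive_tensor_self (X k ω)).smul_of_nonneg
    (by positivity)

theorem empCrossMoment_model {X : ℕ → Ω → H₁} {Y ε : ℕ → Ω → H₂} {Ψ : H₁ →L[ℝ] H₂} {n : ℕ} {ω : Ω}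
    (h : ∀ k, 1 ≤ k → Y k ω = Ψ (X k ω) + ε k ω) :
    empCrossMoment X Y n ω = Ψ ∘L empCrossMoment X X n ω + empCrossMoment X ε n ω := by
  ext x
  simp only [empCrossMoment, _root_.add_apply, ContinuousLinearMap.comp_apply, _root_.smul_apply,
    _root_.sum_apply, tensor_apply, map_smul, map_sum, ← smul_add, ← Finset.sum_add_distrib]
  refine congrArg _ (Finset.sum_congr rfl fun k hk => ?_)
  rw [h k (Finset.mem_Icc.1 hk).1]

variable [MeasurableSpace Ω] {P : Measure Ω}

theorem integrable_tensor {X : Ω → H₁} {Y : Ω → H₂} (hX : MemLp X 2 P) (hY : MemLp Y 2 P) :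
    Integrable (fun ω => tensor (X ω) (Y ω)) P := by
  have hm : AEStronglyMeasurable (fun ω => tensor (X ω) (Y ω)) P :=
    Continuous.comp_aestronglyMeasurable₂ (g := tensor) continuous_tensor hX.1 hY.1
  refine (hX.norm.integrable_mul hY.norm).mono' hm (ae_of_all _ fun ω => ?_)
  rw [norm_tensor, Pi.mul_apply]

/-- Rank one operators are compact, and the compact operators form a closed convex set, which
contains the mean of an integrable variable with values in it. -/
theorem isCompactOperator_crossMoment [CompleteSpace H₂] [IsProbabilityMeasure P] {X : Ω → H₁}
    {Y : Ω → H₂} (hX : MemLp X 2 P) (hY : MemLp Y 2 P) :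
    IsCompactOperator (crossMoment P X Y) :=
  Convex.integral_mem (s := {T : H₁ →L[ℝ] H₂ | IsCompactOperator T})
    (compactOperator (RingHom.id ℝ) H₁ H₂).convex isClosed_setOfPred_isCompactOperator
    (ae_of_all _ fun _ => isCompactOperator_tensor _ _) (integrable_tensor hX hY)

theorem inner_crossMoment_apply [CompleteSpace H₁] {X : Ω → H₁} (hX : MemLp X 2 P) (x y : H₁) :
    ⟪crossMoment P X X x, y⟫_ℝ = ∫ ω, ⟪X ω, x⟫_ℝ * ⟪X ω, y⟫_ℝ ∂P := by
  have hInt := integrable_tensor hX hX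
  rw [crossMoment, ContinuousLinearMap.integral_apply hInt, real_inner_comm,
    ← integral_inner (hInt.apply_continuousLinearMap x)]
  refine integral_congr_ae (ae_of_all _ fun ω => ?_)
  simp [real_inner_smul_right, real_inner_comm y]

theorem isPositive_crossMoment_self [CompleteSpace H₁] {X : Ω → H₁} (hX : MemLp X 2 P) :
    (crossMoment P X X).IsPositive := by
  rw [ContinuousLinearMap.isPositive_iff]
  refine ⟨fun x y => ?_, fun x => ?_⟩
  · simp only [ContinuousLinearMap.coe_coe]
    rw [← real_inner_comm x, inner_crossMoment_apply hX, inner_crossMoment_apply hX]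
    exact integral_congr_ae (ae_of_all _ fun ω => mul_comm _ _)
  · rw [inner_crossMoment_apply hX]
    exact integral_nonneg fun ω => mul_self_nonneg _

end Covariance

end HilbertLM

/-! ### The main theorem -/

theorem theorem1
    {Ω H₁ H₂ S : Type*} [MeasurableSpace Ω] [MeasurableSpace S]
    [NormedAddCommGroup H₁] [InnerProductSpace ℝ H₁] [CompleteSpace H₁]
    [TopologicalSpace.SeparableSpace H₁] [MeasurableSpace H₁] [BorelSpace H₁]
    [NormedAddCommGroup H₂] [InnerProductSpace ℝ H₂] [CompleteSpace H₂]
    [TopologicalSpace.SeparableSpace H₂] [MeasurableSpace H₂] [BorelSpace H₂]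
    (hdim : ¬ FiniteDimensional ℝ H₁)
    (P : Measure Ω) [IsProbabilityMeasure P]
    -- the model
    (Ψ : H₁ →L[ℝ] H₂) (X : ℕ → Ω → H₁) (ε Y : ℕ → Ω → H₂)
    (hmodel : ∀ k, 1 ≤ k → ∀ᵐ ω ∂P, Y k ω = Ψ (X k ω) + ε k ω)
    -- moments and dependence
    (hX0 : ∀ k, 1 ≤ k → ∫ ω, X k ω ∂P = 0)
    (hε0 : ∀ k, 1 ≤ k → ∫ ω, ε k ω ∂P = 0)
    (δ δ' : ℤ → Ω → S) (hδ : HilbertLM.IsIIDWithCopy P δ δ')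
    (f : (ℕ → S) → H₁) (hX : HilbertLM.IsLpmApproximable P 4 δ δ' f X)
    (g : (ℕ → S) → H₂) (hε : HilbertLM.IsLpmApproximable P 4 δ δ' g ε)
    (hwn : HilbertLM.IsWhiteNoise P ε)
    (horth : ∀ k, 1 ≤ k → HilbertLM.Orthogonal P (X k) (ε k))
    -- the covariance operator has full rank and mutually distinct eigenvalues
    (hrank : DenseRange (HilbertLM.covOp P (X 1)))
    (lam : ℕ → ℝ) (v : ℕ → H₁)
    (hlam : HilbertLM.IsEigenSystem (HilbertLM.covOp P (X 1)) lam v)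
    (hdist : Function.Injective lam)
    (hΨ : HilbertLM.IsHilbertSchmidt Ψ)
    -- any choice of the empirical eigenelements
    (lamHat : ℕ → Ω → ℕ → ℝ) (vHat : ℕ → Ω → ℕ → H₁)
    (hHat : ∀ n, 1 ≤ n → ∀ ω,
      HilbertLM.IsEigenSystem (HilbertLM.empCrossMoment X X n ω) (lamHat n ω) (vHat n ω))
    -- the tuning parameter
    (m : ℕ → ℝ) (hm : Tendsto m atTop atTop)
    (hm6 : (fun n => m n ^ 6) =o[atTop] (fun n => (n : ℝ))) :
    TendstoInMeasure P
      (fun n ω =>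
        ‖HilbertLM.pcaOperator (HilbertLM.empCrossMoment X Y n ω) (lamHat n ω) (vHat n ω)
            (HilbertLM.truncK (lamHat n ω) (m n)) - Ψ‖)
      atTop (fun _ => (0 : ℝ)) := by
  open HilbertLM in
  have hX2 : MemLp (X 1) 2 P := (horth 1 le_rfl).1
  have hcov : covOp P (X 1) = crossMoment P (X 1) (X 1) := by
    simp [covOp, hX0 1 le_rfl]
  rw [hcov] at hrank hlam
  set C := crossMoment P (X 1) (X 1) with hC
  have hCpos : C.IsPositive := isPositive_crossMoment_self hX2
  have hCcpt : IsCompactOperator C := isCompactOperator_crossMoment hX2 hX2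
  have hone : (fun _ : ℕ => (1 : ℝ) ^ 2) =o[atTop] fun n => (n : ℝ) := by
    simp only [one_pow]
    exact isLittleO_const_left.2 (Or.inr (by
      simpa [Function.comp_def] using tendsto_natCast_atTop_atTop (R := ℝ)))
  -- The noise term is `m² ‖L‖` with `L` of order `n^{-1/2}`, hence the rate `b n = m n ^ 2`.
  have hm4 : (fun n => (m n ^ 2) ^ 2) =o[atTop] fun n => (n : ℝ) := by
    refine IsBigO.trans_isLittleO (IsBigO.of_bound 1 ?_) hm6
    filter_upwards [hm.eventually_ge_atTop 1] with n hn
    rw [one_mul, ← pow_mul, Real.norm_of_nonneg (by positivity),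
      Real.norm_of_nonneg (by positivity)]
    exact pow_le_pow_right₀ hn (by norm_num)
  rw [tendstoInMeasure_iff_norm]
  intro η hη
  obtain ⟨κ₁, hκ₁, hsmall⟩ := hΨ.exists_norm_comp_le hrank (show 0 < η / 3 by positivity)
  obtain ⟨κ₂, hκ₂, M, hM, htrunc⟩ := hlam.exists_lam_truncK_le hCpos hCcpt hdist hκ₁
  have t1 := tendsto_measure_empCrossMoment_sub hδ hX hX hone (lt_min hκ₁ hκ₂)
  have t2 := tendsto_measure_empCrossMoment_sub hδ hX hε hm4 (show 0 < η / 3 by positivity)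
  have t3 := t1.add t2
  rw [add_zero] at t3
  have hmodel' : ∀ᵐ ω ∂P, ∀ k, 1 ≤ k → Y k ω = Ψ (X k ω) + ε k ω := by
    rw [ae_all_iff]
    intro k
    by_cases hk : 1 ≤ k
    · filter_upwards [hmodel k hk] with ω h _ using h
    · exact ae_of_all _ fun ω h => absurd h hk
  refine tendsto_of_tendsto_of_tendsto_of_le_of_le' tendsto_const_nhds t3
    (Eventually.of_forall fun _ => zero_le) ?_
  filter_upwards [eventually_ge_atTop 1, hm.eventually_ge_atTop M] with n hn hMn
  refine le_trans (measure_mono_ae ?_) (measure_union_le _ _)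
  filter_upwards [hmodel'] with ω hω (hle : η ≤ _)
  -- Off the two exceptional events the argument is deterministic: bias and noise are each at most
  -- `η / 3`, so the error cannot reach `η`.
  by_contra hnot
  obtain ⟨h1, h2⟩ := not_or.1 hnot
  simp only [Set.mem_ofPred_eq, not_le] at h1 h2
  rw [one_mul, norm_sub_rev] at h1
  rw [(horth 1 le_rfl).2.2, sub_zero] at h2
  have hE := hHat n hn ω
  have hpos := isPositive_empCrossMoment_self X n ω
  have hcpt := isCompactOperator_empCrossMoment X X n ω
  have hm0 : 0 < m n := hM.trans_le hMn
  have hlamK := htrunc _ _ _ (m n) hE hpos hcpt (h1.le.trans (min_le_right _ _)) hMn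
  have hres := hsmall (empCrossMoment X X n ω)
    (residual (vHat n ω) (truncK (lamHat n ω) (m n))) (h1.le.trans (min_le_left _ _))
    (HilbertLM.norm_residual_apply_le hE.orthonormal _)
    (inner_residual_comm _ _)
    (fun x => (hE.norm_residual_apply_le hpos hcpt _ x).trans
      (mul_le_mul_of_nonneg_right hlamK (norm_nonneg x)))
  have hKm : ((truncK (lamHat n ω) (m n) : ℕ) : ℝ) ≤ m n :=
    (Nat.cast_le.2 (min_le_right _ _)).trans (Nat.floor_le hm0.le)
  have hfinal := norm_pcaOperator_sub_le hE Ψ (empCrossMoment X ε n ω) hKm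
    fun j hj => inv_le_of_lt_truncK hE.antitone (hE.tendsto_zero hpos hcpt) hm0 hj
  rw [← empCrossMoment_model hω] at hfinal
  rw [sub_zero, norm_norm] at hle
  linarith
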